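/- Let $I=[0,1]$ or $I=\mathbb{S}^1=\mathbb{R}/\mathbb{Z}$. Let $\mathcal{C}^\infty(I,\mathbb{R}^2)/\mathbb{R}^2$ be the vector space of smooth curves $\gamma\colon I\to\mathbb{R}^2$ modulo translations (addition of constants), graded by $$\|\gamma\|_{\mathcal{C}^k}=\sum_{j=1}^k\max_{s\in I}|\gamma^{(j)}(s)|,\qquad k\ge 1.$$ Let $\mathcal{C}(I)=\{\gamma\in\mathcal{C}^\infty(I,\mathbb{R}^2)/\mathbb{R}^2:\ \gamma'(s)\ne 0\ \ \forall s\in I\}$ be the set of immersions modulo translations, an open subset, with the atlas consisting of the inclusion into $\mathcal{C}^\infty(I,\mathbb{R}^2)/\mathbb{R}^2$, and let $$\mathcal{C}_1(I)=\Big\{\gamma\in\mathcal{C}(I):\ \int_0^1|\gamma'(s)|\,ds=1\Big\}.$$ Then $\mathcal{C}(I)$ is a tame Fréchet manifold, and $\mathcal{C}_1(I)$ is a tame $\mathcal{C}^\infty$-submanifold of $\mathcal{C}(I)$. Here the following standard terminology (of Hamilton) is used. A *graded Fréchet space* is a Fréchet space whose topology is defined by a chosen increasing sequence of seminorms $\|\cdot\|_n$;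 products are graded by the sums of the seminorms. A linear map $A\colon F_1\to F_2$ of graded Fréchet spaces is *tame* if there are $r,b$ and constants $C_n$ with $\|Af\|_n\le C_n\|f\|_{n+r}$ for all $n\ge b$ and all $f$. A graded Fréchet space $F$ is *tame* if for some Banach space $B$ there are tame linear maps $L\colon F\to\Sigma(B)$ and $M\colon\Sigma(B)\to F$ with $ML=\mathrm{id}$, where $\Sigma(B)$ is the space of sequences $(f_k)_{k\ge 0}$ in $B$ with $\|(f_k)\|_n=\sum_k e^{nk}\|f_k\|_B<\infty$ for all $n\geq 0$. A map $P\colon U\to F_2$ on a subset $U\subset F_1$ is *tame* if it is continuous and near each point of $U$ there are $r,b,C_n$ with $\|P(f)\|_n\le C_n(1+\|f\|_{n+r})$ for all $n\ge b$. When $U$ is open, $P$ is *smooth tame* if all iterated directional derivatives $D^kP\colon U\times F_1^k\to F_2$, $k\ge 0$, exist and are tame (in particular jointly continuous). A *tame Fréchet manifold* is a Hausdorff space with an atlas of charts in tame Fréchet spaces whose transition maps are smooth tame. A subset $N$ of a tame Fréchet manifold $M$ is a *tame $\mathcal{C}^\infty$-submanifold* if $N$ is closed in $M$ and every point of $N$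 lies in the domain $W$ of a chart $\varphi\colon W\to E\times F$ of $M$, compatible with the atlas through transition maps that are smooth tame in both directions, with $E$ and $F$ tame Fréchet spaces, such that $N\cap W=\varphi^{-1}(E\times\{0\})$. -/

import Mathlib

open Set Filter Topology MeasureTheory
open scoped ContDiff

noncomputable section

namespace TameFrechet

/-! ## Graded spaces and tame Fréchet spaces -/

/-- A real vector space with an increasing sequence of seminorms (a grading). -/
structure GradedSpace : Type 1 where
  carrier : Type
  [instAddCommGroup : AddCommGroup carrier]
  [instModule : Module ℝ carrier]
  seminorm : ℕ → Seminorm ℝ carrier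
  mono : Monotone seminorm

namespace GradedSpace

instance : CoeSort GradedSpace Type := ⟨GradedSpace.carrier⟩

attribute [instance] GradedSpace.instAddCommGroup GradedSpace.instModule

/-- A graded space carries the locally convex topology defined by its seminorms. -/
instance (F : GradedSpace) : TopologicalSpace F :=
  (SeminormFamily.moduleFilterBasis (𝕜 := ℝ) F.seminorm).topology

theorem withSeminorms (F : GradedSpace) : WithSeminorms (𝕜 := ℝ) F.seminorm := ⟨rfl⟩

/-- The grading defines a Fréchet space: the topology is Hausdorff and every Cauchy sequence
converges (the topology is defined by countably many seminorms, so sequences suffice). -/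
structure IsFrechet (F : GradedSpace) : Prop where
  separated : ∀ x : F, (∀ n, F.seminorm n x = 0) → x = 0
  complete : ∀ u : ℕ → F,
    (∀ n, ∀ ε > 0, ∃ N, ∀ i ≥ N, ∀ j ≥ N, F.seminorm n (u i - u j) < ε) →
    ∃ x : F, ∀ n, Tendsto (fun i => F.seminorm n (u i - x)) atTop (𝓝 0)

/-- The product of two graded spaces, graded by `‖(x, y)‖ₙ = ‖x‖ₙ + ‖y‖ₙ`. -/
def prod (E F : GradedSpace) : GradedSpace where
  carrier := E × F
  seminorm n := (E.seminorm n).comp (LinearMap.fst ℝ E F) + (F.seminorm n).comp (LinearMap.snd ℝ E F)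
  mono := fun _ _ h x => add_le_add (E.mono h x.1) (F.mono h x.2)

/-- The power `E ^ k`, graded by `‖(h₁, …, hₖ)‖ₙ = ∑ᵢ ‖hᵢ‖ₙ`. -/
def pow (E : GradedSpace) (k : ℕ) : GradedSpace where
  carrier := Fin k → E
  seminorm n := ∑ i, (E.seminorm n).comp (LinearMap.proj i)
  mono := fun _ _ h => Finset.sum_le_sum fun i _ x => E.mono h (x i)

/-- A linear map between graded spaces is tame if `‖L x‖ₙ ≤ Cₙ ‖x‖ₙ₊ᵣ` for all `n ≥ b`. -/
def IsTameLinear {E F : GradedSpace} (L : E →ₗ[ℝ] F) : Prop :=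
  ∃ (r b : ℕ) (C : ℕ → ℝ), ∀ n ≥ b, ∀ x : E, F.seminorm n (L x) ≤ C n * E.seminorm (n + r) x

/-- `F` is a tame direct summand of `G`. -/
def IsTameSummand (F G : GradedSpace) : Prop :=
  ∃ (L : F →ₗ[ℝ] G) (M : G →ₗ[ℝ] F), IsTameLinear L ∧ IsTameLinear M ∧ ∀ x, M (L x) = x

end GradedSpace

/-- The vector space of exponentially decreasing sequences in `B`. -/
def expDecSubmodule (B : Type) [NormedAddCommGroup B] [NormedSpace ℝ B] :
    Submodule ℝ (ℕ → B) where
  carrier := {f | ∀ n : ℕ, Summable fun k : ℕ => Real.exp (n * k) * ‖f k‖}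
  zero_mem' := by intro n; simp
  add_mem' := by
    intro f g hf hg n
    refine Summable.of_nonneg_of_le (fun k => by positivity) (fun k => ?_) ((hf n).add (hg n))
    rw [← mul_add]
    exact mul_le_mul_of_nonneg_left (norm_add_le _ _) (Real.exp_pos _).le
  smul_mem' := by
    intro c f hf n
    refine ((hf n).mul_left |c|).congr fun k => ?_
    simp only [Pi.smul_apply, norm_smul, Real.norm_eq_abs]
    ring

/-- The graded space `Σ(B)`, with `‖f‖ₙ = ∑ₖ e ^ (n k) ‖f k‖`. -/
def expDec (B : Type) [NormedAddCommGroup B] [NormedSpace ℝ B] : GradedSpace where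
  carrier := expDecSubmodule B
  seminorm n := Seminorm.of (fun f => ∑' k : ℕ, Real.exp (n * k) * ‖f.1 k‖)
    (by
      intro f g
      rw [← (f.2 n).tsum_add (g.2 n)]
      refine ((f + g).2 n).tsum_le_tsum (fun k => ?_) ((f.2 n).add (g.2 n))
      rw [← mul_add]
      exact mul_le_mul_of_nonneg_left (norm_add_le _ _) (Real.exp_pos _).le)
    (by
      intro c f
      rw [← tsum_mul_left]
      refine tsum_congr fun k => ?_
      simp only [Submodule.coe_smul, Pi.smul_apply, norm_smul]
      ring)
  mono := by
    intro m n h f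
    refine (f.2 m).tsum_le_tsum (fun k => ?_) (f.2 n)
    have h' : (m : ℝ) ≤ n := by exact_mod_cast h
    gcongr

/-- A tame Fréchet space is a graded Fréchet space which is a tame direct summand of `Σ(B)` for
some Banach space `B`. -/
def GradedSpace.IsTame (F : GradedSpace) : Prop :=
  F.IsFrechet ∧ ∃ (B : Type) (_ : NormedAddCommGroup B) (_ : NormedSpace ℝ B),
    CompleteSpace B ∧ F.IsTameSummand (expDec B)

/-! ## Smooth tame maps -/

/-- `P` is tame on `U`: it is continuous and near each point of `U` it satisfies an estimate
`‖P x‖ₙ ≤ Cₙ (1 + ‖x‖ₙ₊ᵣ)` for all `n ≥ b`. -/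
def IsTameOn {E F : GradedSpace} (P : E → F) (U : Set E) : Prop :=
  ContinuousOn P U ∧ ∀ x ∈ U, ∃ W ∈ 𝓝 x, ∃ (r b : ℕ) (C : ℕ → ℝ),
    ∀ y ∈ W ∩ U, ∀ n ≥ b, F.seminorm n (P y) ≤ C n * (1 + E.seminorm (n + r) y)

/-- `P` is a smooth tame map on the open set `U`: all its iterated directional derivatives
`Dᵏ P (x) {h₁, …, hₖ}` exist, and each `Dᵏ P : U × Eᵏ → F` is (jointly continuous and) tame. -/
def IsSmoothTameOn {E F : GradedSpace} (P : E → F) (U : Set E) : Prop :=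
  ∃ D : (k : ℕ) → E.prod (E.pow k) → F,
    (∀ x ∈ U, ∀ h, D 0 (x, h) = P x) ∧
    (∀ k, ∀ x ∈ U, ∀ (h : Fin k → E) (v : E),
      Tendsto (fun t : ℝ => t⁻¹ • (D k (x + t • v, h) - D k (x, h))) (𝓝[≠] 0)
        (𝓝 (D (k + 1) (x, Fin.snoc (α := fun _ => E) h v)))) ∧
    ∀ k, IsTameOn (D k) {z | Prod.fst z ∈ U}

/-! ## Tame Fréchet manifolds and tame submanifolds -/

/-- A chart: a homeomorphism from an open subset of `M` to an open subset of a graded space. -/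
structure Chart (M : Type) [TopologicalSpace M] where
  model : GradedSpace
  toHomeo : OpenPartialHomeomorph M model

/-- The transition maps between the two charts are smooth tame, in both directions. -/
def Chart.Compatible {M : Type} [TopologicalSpace M] (c c' : Chart M) : Prop :=
  IsSmoothTameOn (c'.toHomeo ∘ c.toHomeo.symm) (c.toHomeo.symm.trans c'.toHomeo).source ∧
  IsSmoothTameOn (c.toHomeo ∘ c'.toHomeo.symm) (c'.toHomeo.symm.trans c.toHomeo).source

/-- The atlas `A` makes the Hausdorff space `M` a tame Fréchet manifold. -/
structure IsTameManifold (M : Type) [TopologicalSpace M] (A : Set (Chart M)) : Prop where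
  hausdorff : T2Space M
  tame : ∀ c ∈ A, c.model.IsTame
  cover : ∀ x : M, ∃ c ∈ A, x ∈ c.toHomeo.source
  compatible : ∀ c ∈ A, ∀ c' ∈ A, c.Compatible c'

/-- `N` is a (smooth) tame submanifold of `M`: it is closed, and each of its points is in the domain
of a chart of the maximal atlas, with values in a product `E × F` of tame Fréchet spaces, in which
`N` is given by the vanishing of the component in `F`. -/
def IsTameSubmanifold {M : Type} [TopologicalSpace M] (A : Set (Chart M)) (N : Set M) : Prop :=
  IsClosed N ∧ ∀ x ∈ N, ∃ (E F : GradedSpace) (φ : OpenPartialHomeomorph M (E.prod F)),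
    E.IsTame ∧ F.IsTame ∧ (∀ c ∈ A, Chart.Compatible ⟨E.prod F, φ⟩ c) ∧
    x ∈ φ.source ∧ ∀ y ∈ φ.source, y ∈ N ↔ Prod.snd (φ y) = 0

/-! ## Smooth curves modulo translations -/

/-- The two parameter domains `[0, 1]` and `ℝ / ℤ`. -/
inductive Domain
  | interval
  | circle

namespace Domain

/-- The points of the domain. -/
def Pt : Domain → Type
  | interval => unitInterval
  | circle => UnitAddCircle

/-- The set of real parameters: `[0, 1]` for the interval, `ℝ` for the circle. -/
def param : Domain → Set ℝ
  | interval => Icc 0 1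
  | circle => univ

/-- The point of the domain with a given parameter (for the interval, only parameters in `[0, 1]`
matter). -/
def proj : (I : Domain) → ℝ → I.Pt
  | interval => projIcc 0 1 zero_le_one
  | circle => fun t => (t : UnitAddCircle)

theorem uniqueDiffOn_param (I : Domain) : UniqueDiffOn ℝ I.param := by
  cases I
  · exact uniqueDiffOn_Icc zero_lt_one
  · exact uniqueDiffOn_univ

theorem mem_param (I : Domain) (s : unitInterval) : (s : ℝ) ∈ I.param := by
  cases I
  · exact s.2
  · trivial

end Domain

/-- The vector space of smooth maps `I → V`. At the end points of `[0, 1]`, smoothness and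
derivatives are one-sided. -/
def smoothSubmodule (I : Domain) (V : Type) [NormedAddCommGroup V] [NormedSpace ℝ V] :
    Submodule ℝ (I.Pt → V) where
  carrier := {f | ContDiffOn ℝ ∞ (f ∘ I.proj) I.param}
  zero_mem' := contDiffOn_const (c := (0 : V))
  add_mem' := fun hf hg => ContDiffOn.add hf hg
  smul_mem' := fun c _ hf => ContDiffOn.const_smul c hf

/-- `C^∞(I, V)` as a vector space. -/
def SmoothMap (I : Domain) (V : Type) [NormedAddCommGroup V] [NormedSpace ℝ V] : Type :=
  smoothSubmodule I V

section SmoothMap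

variable (I : Domain) (V : Type) [NormedAddCommGroup V] [NormedSpace ℝ V]

instance : AddCommGroup (SmoothMap I V) := inferInstanceAs (AddCommGroup (smoothSubmodule I V))

instance : Module ℝ (SmoothMap I V) := inferInstanceAs (Module ℝ (smoothSubmodule I V))

theorem SmoothMap.contDiffWithinAt {I : Domain} {V : Type} [NormedAddCommGroup V]
    [NormedSpace ℝ V] (f : SmoothMap I V) (j : ℕ) (s : unitInterval) :
    ContDiffWithinAt ℝ j (f.1 ∘ I.proj) I.param s :=
  (ContDiffOn.of_le f.2 (by exact_mod_cast le_top)) s (I.mem_param s)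

/-- The `j`-th derivative of a smooth map, as a function of the parameter `s ∈ [0, 1]`. -/
def iterDeriv (j : ℕ) : SmoothMap I V →ₗ[ℝ] (unitInterval → V) where
  toFun f := fun s => iteratedDerivWithin j (f.1 ∘ I.proj) I.param s
  map_add' f g := by
    funext s
    exact iteratedDerivWithin_add (I.mem_param s) I.uniqueDiffOn_param
      (f.contDiffWithinAt j s) (g.contDiffWithinAt j s)
  map_smul' c f := by
    funext s
    exact iteratedDerivWithin_const_smul (I.mem_param s) I.uniqueDiffOn_param c
      (f.contDiffWithinAt j s)

/-- The translations: the subspace of constant maps. -/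
def constMaps : Submodule ℝ (SmoothMap I V) where
  carrier := {f | ∃ v : V, ∀ p, f.1 p = v}
  zero_mem' := ⟨0, fun _ => rfl⟩
  add_mem' := by
    rintro f g ⟨v, hv⟩ ⟨w, hw⟩
    exact ⟨v + w, fun p => congrArg₂ (· + ·) (hv p) (hw p)⟩
  smul_mem' := by
    rintro c f ⟨v, hv⟩
    exact ⟨c • v, fun p => congrArg (c • ·) (hv p)⟩

/-- `C^∞(I, V) / V`, smooth maps modulo translations. -/
def CurveMod : Type := SmoothMap I V ⧸ constMaps I V

instance : AddCommGroup (CurveMod I V) :=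
  inferInstanceAs (AddCommGroup (SmoothMap I V ⧸ constMaps I V))

instance : Module ℝ (CurveMod I V) :=
  inferInstanceAs (Module ℝ (SmoothMap I V ⧸ constMaps I V))

theorem iterDeriv_const (j : ℕ) : constMaps I V ≤ LinearMap.ker (iterDeriv I V (j + 1)) := by
  rintro f ⟨v, hv⟩
  rw [LinearMap.mem_ker]
  funext s
  have : f.1 ∘ I.proj = fun _ => v := funext fun t => hv _
  change iteratedDerivWithin (j + 1) (f.1 ∘ I.proj) I.param s = 0
  rw [this, iteratedDerivWithin_const, if_neg (Nat.succ_ne_zero j)]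

/-- The derivative of order `j + 1` of a smooth map modulo translations. -/
def derivMod (j : ℕ) : CurveMod I V →ₗ[ℝ] (unitInterval → V) :=
  (constMaps I V).liftQ (iterDeriv I V (j + 1)) (iterDeriv_const I V j)

/-- The class modulo translations of a smooth map. -/
def toCurveMod : SmoothMap I V →ₗ[ℝ] CurveMod I V := (constMaps I V).mkQ

theorem derivMod_toCurveMod (j : ℕ) (f : SmoothMap I V) (s : unitInterval) :
    derivMod I V j (toCurveMod I V f) s = iteratedDerivWithin (j + 1) (f.1 ∘ I.proj) I.param s :=
  rfl

theorem derivMod_continuous (j : ℕ) (q : CurveMod I V) : Continuous (derivMod I V j q) := by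
  obtain ⟨f, rfl⟩ := Submodule.mkQ_surjective (constMaps I V) q
  have h : ContinuousOn (iteratedDerivWithin (j + 1) (f.1 ∘ I.proj) I.param) I.param :=
    ContDiffOn.continuousOn_iteratedDerivWithin f.2 (by exact_mod_cast le_top) I.uniqueDiffOn_param
  exact h.comp_continuous continuous_subtype_val I.mem_param

theorem derivMod_bddAbove (j : ℕ) (q : CurveMod I V) :
    BddAbove (range fun s => ‖derivMod I V j q s‖) :=
  (isCompact_range (derivMod_continuous I V j q).norm).bddAbove

/-- The seminorm `‖γ‖_{C^k} = ∑_{j = 1}^k max_s |γ^{(j)}(s)|` on smooth maps modulo translations. -/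
def ckSeminorm (k : ℕ) : Seminorm ℝ (CurveMod I V) :=
  Seminorm.of (fun q => ∑ j ∈ Finset.range k, ⨆ s, ‖derivMod I V j q s‖)
    (by
      intro p q
      rw [← Finset.sum_add_distrib]
      refine Finset.sum_le_sum fun j _ => ciSup_le fun s => ?_
      rw [map_add]
      exact (norm_add_le _ _).trans (add_le_add (le_ciSup (derivMod_bddAbove I V j p) s)
        (le_ciSup (derivMod_bddAbove I V j q) s)))
    (by
      intro c q
      rw [Finset.mul_sum]
      refine Finset.sum_congr rfl fun j _ => ?_
      rw [Real.mul_iSup_of_nonneg (norm_nonneg c)]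
      refine iSup_congr fun s => ?_
      rw [map_smul, Pi.smul_apply, norm_smul])

/-- The graded space `C^∞(I, V) / V` with the seminorms `‖·‖_{C^k}`. The index `k = 0` gives the
zero seminorm, which affects neither the topology nor the notion of tameness. -/
def curveGraded : GradedSpace where
  carrier := CurveMod I V
  seminorm := ckSeminorm I V
  mono := fun _ _ h _ => Finset.sum_le_sum_of_subset_of_nonneg (Finset.range_mono h)
    fun _ _ _ => Real.iSup_nonneg fun _ => norm_nonneg _

end SmoothMap

/-! ## Immersions and length-one immersions in the plane -/

/-- The Euclidean plane. -/
abbrev Plane : Type := EuclideanSpace ℝ (Fin 2)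

/-- The set of immersions in `C^∞(I, ℝ²) / ℝ²`. -/
def immersionSet (I : Domain) : Set (curveGraded I Plane) :=
  {γ | ∀ s, derivMod I Plane 0 γ s ≠ 0}

theorem isOpen_immersionSet (I : Domain) : IsOpen (immersionSet I) := by
  rw [isOpen_iff_mem_nhds]
  intro γ hγ
  obtain ⟨s₀, -, h₀⟩ := isCompact_univ.exists_isMinOn univ_nonempty
    (derivMod_continuous I Plane 0 γ).norm.continuousOn
  have hpos : 0 < ‖derivMod I Plane 0 γ s₀‖ := norm_pos_iff.2 (hγ s₀)
  rw [(GradedSpace.withSeminorms (curveGraded I Plane)).mem_nhds_iff]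
  refine ⟨{1}, _, hpos, fun η hη s hs => ?_⟩
  rw [Finset.sup_singleton, Seminorm.mem_ball] at hη
  change ∑ j ∈ Finset.range 1, ⨆ s, ‖derivMod I Plane j (η - γ) s‖ < _ at hη
  rw [Finset.sum_range_one] at hη
  have h1 := le_ciSup (derivMod_bddAbove I Plane 0 (η - γ)) s
  have h2 : ‖derivMod I Plane 0 γ s₀‖ ≤ ‖derivMod I Plane 0 γ s‖ := h₀ (mem_univ s)
  have h3 : derivMod I Plane 0 (η - γ) s = derivMod I Plane 0 η s - derivMod I Plane 0 γ s :=
    congrFun (map_sub (derivMod I Plane 0) (η : CurveMod I Plane) γ) s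
  rw [h3, hs, zero_sub, norm_neg] at h1
  linarith

/-- The space `C(I)` of immersions modulo translations, an open subset of `C^∞(I, ℝ²) / ℝ²`. -/
def immersions (I : Domain) : TopologicalSpace.Opens (curveGraded I Plane) :=
  ⟨immersionSet I, isOpen_immersionSet I⟩

theorem nonempty_immersions (I : Domain) : Nonempty (immersions I) := by
  have key : ∃ f : SmoothMap I Plane, ∀ s, iterDeriv I Plane 1 f s ≠ 0 := by
    cases I with
    | interval =>
      have hc : EqOn ((fun p : unitInterval => (!₂[(p : ℝ), 0] : Plane)) ∘ Domain.interval.proj)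
          (fun t : ℝ => (!₂[t, 0] : Plane)) (Icc 0 1) := by
        intro t ht
        simp [Domain.proj, projIcc_of_mem zero_le_one ht]
      have hd : ContDiff ℝ ∞ (fun t : ℝ => (!₂[t, 0] : Plane)) := by
        rw [contDiff_euclidean]
        intro i
        fin_cases i
        · exact contDiff_id
        · exact contDiff_const
      refine ⟨⟨fun p : unitInterval => !₂[(p : ℝ), 0], hd.contDiffOn.congr hc⟩, fun s hs => ?_⟩
      change iteratedDerivWithin 1 ((fun p : unitInterval => (!₂[(p : ℝ), 0] : Plane)) ∘
        Domain.interval.proj) (Icc 0 1) (s : ℝ) = 0 at hs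
      rw [iteratedDerivWithin_one, derivWithin_congr hc (hc s.2)] at hs
      have hu : UniqueDiffWithinAt ℝ (Icc (0 : ℝ) 1) s := uniqueDiffOn_Icc zero_lt_one _ s.2
      have h1 := (hd.differentiable (by simp)).differentiableAt (x := (s : ℝ))
        |>.differentiableWithinAt (s := Icc 0 1) |>.hasDerivWithinAt
      rw [hs] at h1
      have h2 := (EuclideanSpace.proj (𝕜 := ℝ) (0 : Fin 2)).hasFDerivAt.comp_hasDerivWithinAt
        (s : ℝ) h1
      have h3 := (h2.derivWithin hu).symm.trans (derivWithin_id (s : ℝ) (Icc 0 1) hu)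
      simp at h3
    | circle =>
      have hper : Function.Periodic (fun t : ℝ => (!₂[Real.cos (2 * Real.pi * t),
          Real.sin (2 * Real.pi * t)] : Plane)) 1 := by
        intro t
        simp [mul_add]
      have hd : ContDiff ℝ ∞ (fun t : ℝ => (!₂[Real.cos (2 * Real.pi * t),
          Real.sin (2 * Real.pi * t)] : Plane)) := by
        rw [contDiff_euclidean]
        intro i
        fin_cases i
        · exact Real.contDiff_cos.comp (contDiff_const.mul contDiff_id)
        · exact Real.contDiff_sin.comp (contDiff_const.mul contDiff_id)
      refine ⟨⟨hper.lift, hd.contDiffOn⟩, fun s hs => ?_⟩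
      change iteratedDerivWithin 1 (fun t : ℝ => (!₂[Real.cos (2 * Real.pi * t),
          Real.sin (2 * Real.pi * t)] : Plane)) univ (s : ℝ) = 0 at hs
      rw [iteratedDerivWithin_one, derivWithin_univ] at hs
      have h1 := ((hd.differentiable (by simp)).differentiableAt (x := (s : ℝ))).hasDerivAt
      rw [hs] at h1
      have h0 := fun i : Fin 2 =>
        (EuclideanSpace.proj (𝕜 := ℝ) i).hasFDerivAt.comp_hasDerivAt (s : ℝ) h1
      have hl : HasDerivAt (fun t : ℝ => 2 * Real.pi * t) (2 * Real.pi) (s : ℝ) := by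
        simpa using (hasDerivAt_id (s : ℝ)).const_mul (2 * Real.pi)
      have hcos := (h0 0).unique hl.cos
      have hsin := (h0 1).unique hl.sin
      have hpi := Real.pi_ne_zero
      simp at hcos hsin
      have := Real.sin_sq_add_cos_sq (2 * Real.pi * (s : ℝ))
      simp_all
  obtain ⟨f, hf⟩ := key
  exact ⟨⟨toCurveMod I Plane f, hf⟩⟩

/-- The manifold structure of `C(I)`: the atlas whose only chart is the inclusion of the open set
`C(I)` in the graded space `C^∞(I, ℝ²) / ℝ²`. -/
def immersionAtlas (I : Domain) : Set (Chart (immersions I)) :=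
  {⟨curveGraded I Plane, (immersions I).openPartialHomeomorphSubtypeCoe (nonempty_immersions I)⟩}

/-- The set `C₁(I)` of length-one immersions modulo translations. -/
def lengthOne (I : Domain) : Set (immersions I) :=
  {γ | ∫ s : unitInterval, ‖derivMod I Plane 0 γ.1 s‖ = 1}

end TameFrechet

end

/-! Two independent facts carry the theorem: the model space `C^∞(I, ℝ²) / ℝ²` is tame, and the
length functional, being positively homogeneous, can be straightened by an explicit chart.

Submanifold. Write `T γ = γ'` in the Banach space of continuous maps and let `N` be the integral of
the norm there. Near a length-one `p` choose a continuous functional `m` with `m (T p) = 1`. The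
rays of the half-space `m (T x) > 0` are labelled by their points on the hyperplane `m (T x) = 1`,
and `N (T x)` is a coordinate along each ray by homogeneity. So `x ↦ (x / m (T x) - p, N (T x) - 1)`
is a chart flattening `N = 1`, with the inverse in closed form; no inverse function theorem in
Fréchet spaces is needed (`exists_chart_of_homogeneous`). Both directions are finite sums of terms
"smooth scalar function of finitely many Banach-valued data, times a tame affine map". This class
(`IsSymbol`) is stable under directional derivatives by the product rule, and its members are tame
because the scalar factors are locally bounded independently of the degree.

Tameness on the circle. Differentiation multiplies the `m`-th Fourier coefficient by `2πim`, so
after grouping the nonzero frequencies into blocks `e ^ k ≤ |m| ≤ e ^ (k + 1)` the weight `e ^ (nk)`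
of `Σ(B)` measures `n` derivatives. Analysis loses one derivative to make the sum over blocks
converge; synthesis loses two for `∑ 1 / m²`. Frequency zero is the translation part.

Tameness on the interval. The space is a tame summand of the one for the circle: embed `[0, 1]` as
an arc, split a function by a cutoff into a piece at each end, and extend each piece across its end
point by Seeley's reflection `∑ aₖ f(-4ᵏ x)`, where `∑ aₖ (-4ᵏ)ⁿ = 1` for every `n` makes all
derivatives match (`exists_reflection_coefficients`). Restriction to the arc is the retraction. -/

noncomputable section

namespace TameFrechet

/-! ### Topology of graded spaces -/

namespace GradedSpace

instance (F : GradedSpace) : IsTopologicalAddGroup F := F.withSeminorms.topologicalAddGroup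

instance (F : GradedSpace) : ContinuousSMul ℝ F := F.withSeminorms.continuousSMul

theorem IsFrechet.t2Space {F : GradedSpace} (hF : F.IsFrechet) : T2Space F := by
  have : T1Space F := F.withSeminorms.T1_of_separating fun x hx => by
    by_contra! h
    exact hx (hF.separated x h)
  infer_instance

theorem seminorm_le (F : GradedSpace) {m n : ℕ} (h : m ≤ n) (x : F) :
    F.seminorm m x ≤ F.seminorm n x := F.mono h x

/-- A linear map each of whose seminorms is dominated by a seminorm is continuous. -/
theorem continuous_of_bound {E F : GradedSpace} (L : E →ₗ[ℝ] F)
    (h : ∀ n, ∃ (m : ℕ) (C : ℝ), ∀ x, F.seminorm n (L x) ≤ C * E.seminorm m x) :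
    Continuous L := by
  rw [continuous_iff_continuousAt]
  intro x
  rw [ContinuousAt, F.withSeminorms.tendsto_nhds]
  intro n ε hε
  obtain ⟨m, C, hC⟩ := h n
  have h1 : Tendsto (fun y => C * E.seminorm m (y - x)) (𝓝 x) (𝓝 (C * E.seminorm m (x - x))) :=
    (((E.withSeminorms.continuous_seminorm m).comp (continuous_id.sub continuous_const)).tendsto
      x).const_mul C
  rw [sub_self, map_zero, mul_zero] at h1
  filter_upwards [h1.eventually_lt_const hε] with y hy
  rw [← map_sub]
  exact (hC _).trans_lt hy

theorem continuous_of_norm_bound {E : GradedSpace} {X : Type*} [NormedAddCommGroup X]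
    [NormedSpace ℝ X] (L : E →ₗ[ℝ] X) {m : ℕ} {C : ℝ}
    (h : ∀ x, ‖L x‖ ≤ C * E.seminorm m x) : Continuous L := by
  rw [continuous_iff_continuousAt]
  intro x
  rw [ContinuousAt, tendsto_iff_norm_sub_tendsto_zero]
  have h1 : Tendsto (fun y => C * E.seminorm m (y - x)) (𝓝 x) (𝓝 (C * E.seminorm m (x - x))) :=
    (((E.withSeminorms.continuous_seminorm m).comp (continuous_id.sub continuous_const)).tendsto
      x).const_mul C
  rw [sub_self, map_zero, mul_zero] at h1
  refine squeeze_zero (fun _ => norm_nonneg _) (fun y => ?_) h1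
  rw [← map_sub]
  exact h _

/-! ### Tame linear maps -/

theorem IsTameLinear.exists_nonneg {E F : GradedSpace} {L : E →ₗ[ℝ] F} (hL : IsTameLinear L) :
    ∃ (r b : ℕ) (C : ℕ → ℝ), (∀ n, 0 ≤ C n) ∧
      ∀ n ≥ b, ∀ x : E, F.seminorm n (L x) ≤ C n * E.seminorm (n + r) x := by
  obtain ⟨r, b, C, h⟩ := hL
  exact ⟨r, b, fun n => |C n|, fun n => abs_nonneg _, fun n hn x => (h n hn x).trans
    (mul_le_mul_of_nonneg_right (le_abs_self _) (apply_nonneg _ _))⟩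

/-- Tame estimates start only at the base degree; below it, monotonicity of the grading borrows the
estimate in degree `max n b`. -/
theorem IsTameLinear.bound {E F : GradedSpace} {L : E →ₗ[ℝ] F} (hL : IsTameLinear L) (n : ℕ) :
    ∃ (m : ℕ) (C : ℝ), 0 ≤ C ∧ ∀ x, F.seminorm n (L x) ≤ C * E.seminorm m x := by
  obtain ⟨r, b, C, hC, h⟩ := hL.exists_nonneg
  exact ⟨max n b + r, C (max n b), hC _, fun x =>
    (F.seminorm_le (le_max_left n b) _).trans (h _ (le_max_right n b) x)⟩

theorem IsTameLinear.continuous {E F : GradedSpace} {L : E →ₗ[ℝ] F} (hL : IsTameLinear L) :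
    Continuous L :=
  continuous_of_bound L fun n => let ⟨m, C, _, h⟩ := hL.bound n; ⟨m, C, h⟩

theorem isTameLinear_id (E : GradedSpace) : IsTameLinear (LinearMap.id : E →ₗ[ℝ] E) :=
  ⟨0, 0, fun _ => 1, fun n _ x => by simp⟩

theorem isTameLinear_zero (E F : GradedSpace) : IsTameLinear (0 : E →ₗ[ℝ] F) :=
  ⟨0, 0, fun _ => 0, fun n _ x => by simp⟩

theorem IsTameLinear.comp {E F G : GradedSpace} {L : F →ₗ[ℝ] G} {M : E →ₗ[ℝ] F}
    (hL : IsTameLinear L) (hM : IsTameLinear M) : IsTameLinear (L ∘ₗ M) := by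
  obtain ⟨r, b, C, hC, h⟩ := hL.exists_nonneg
  obtain ⟨r', b', C', hC', h'⟩ := hM.exists_nonneg
  refine ⟨r + r', max b b', fun n => C n * C' (n + r), fun n hn x => ?_⟩
  rw [mul_assoc, ← add_assoc]
  exact (h n (le_of_max_le_left hn) _).trans (mul_le_mul_of_nonneg_left
    (h' _ ((le_of_max_le_right hn).trans (Nat.le_add_right _ _)) x) (hC n))

theorem isTameLinear_fst (E F : GradedSpace) :
    IsTameLinear (E := E.prod F) (F := E) (LinearMap.fst ℝ E F) :=
  ⟨0, 0, fun _ => 1, fun n _ x => by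
    rw [one_mul]
    exact le_add_of_nonneg_right (apply_nonneg (F.seminorm n) x.2)⟩

theorem isTameLinear_snd (E F : GradedSpace) :
    IsTameLinear (E := E.prod F) (F := F) (LinearMap.snd ℝ E F) :=
  ⟨0, 0, fun _ => 1, fun n _ x => by
    rw [one_mul]
    exact le_add_of_nonneg_left (apply_nonneg (E.seminorm n) x.1)⟩

theorem isTameLinear_inl (E F : GradedSpace) :
    IsTameLinear (E := E) (F := E.prod F) (LinearMap.inl ℝ E F) :=
  ⟨0, 0, fun _ => 1, fun n _ x => by
    rw [one_mul]
    change E.seminorm n x + F.seminorm n 0 ≤ _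
    simp⟩

theorem pow_seminorm_apply (E : GradedSpace) (k n : ℕ) (h : Fin k → E) :
    (E.pow k).seminorm n h = ∑ i, E.seminorm n (h i) := by
  have : ∀ s : Finset (Fin k), (∑ i ∈ s, (E.seminorm n).comp
      (LinearMap.proj (R := ℝ) (φ := fun _ : Fin k => (E : Type)) i)) h =
      ∑ i ∈ s, E.seminorm n (h i) := by
    classical
    intro s
    induction s using Finset.induction_on with
    | empty => rfl
    | insert a s ha ih => rw [Finset.sum_insert ha, Finset.sum_insert ha, ← ih]; rfl
  exact this _

theorem seminorm_le_pow (E : GradedSpace) {k : ℕ} (n : ℕ) (h : Fin k → E) (i : Fin k) :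
    E.seminorm n (h i) ≤ (E.pow k).seminorm n h := by
  rw [pow_seminorm_apply]
  exact Finset.single_le_sum (f := fun i => E.seminorm n (h i))
    (fun i _ => apply_nonneg (E.seminorm n) _) (Finset.mem_univ i)

theorem isTameLinear_proj (E : GradedSpace) {k : ℕ} (i : Fin k) :
    IsTameLinear (E := E.pow k) (F := E) (LinearMap.proj (R := ℝ) (φ := fun _ => (E : Type)) i) :=
  ⟨0, 0, fun _ => 1, fun n _ x => by
    rw [one_mul]
    exact E.seminorm_le_pow n x i⟩

/-! ### Tame direct summands and tame spaces -/

theorem IsTameSummand.trans {E F G : GradedSpace} (h : E.IsTameSummand F)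
    (h' : F.IsTameSummand G) : E.IsTameSummand G := by
  obtain ⟨L, M, hL, hM, hLM⟩ := h
  obtain ⟨L', M', hL', hM', hLM'⟩ := h'
  exact ⟨L' ∘ₗ L, M ∘ₗ M', hL'.comp hL, hM.comp hM', fun x => by simp [hLM', hLM]⟩

/-- A retraction transports completeness: `L` sends a Cauchy sequence to a Cauchy sequence, and `M`
sends its limit back, since `M (L (u i)) = u i`. -/
theorem IsTameSummand.isFrechet {F G : GradedSpace} (h : F.IsTameSummand G) (hG : G.IsFrechet) :
    F.IsFrechet := by
  obtain ⟨L, M, hL, hM, hLM⟩ := h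
  refine ⟨fun x hx => ?_, fun u hu => ?_⟩
  · rw [← hLM x, hG.separated (L x) fun n => ?_, map_zero]
    obtain ⟨m, C, -, h⟩ := hL.bound n
    refine le_antisymm ((h x).trans ?_) (apply_nonneg _ _)
    rw [hx, mul_zero]
  · obtain ⟨y, hy⟩ := hG.complete (fun i => L (u i)) fun n ε hε => by
      obtain ⟨m, C, hC, h⟩ := hL.bound n
      -- Dividing by `C + 1` rather than `C` covers `C = 0`.
      obtain ⟨N, hN⟩ := hu m (ε / (C + 1)) (by positivity)
      refine ⟨N, fun i hi j hj => ?_⟩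
      rw [← map_sub]
      have h1 := hN i hi j hj
      rw [lt_div_iff₀ (by positivity)] at h1
      have h2 := h (u i - u j)
      nlinarith [apply_nonneg (F.seminorm m) (u i - u j)]
    refine ⟨M y, fun n => ?_⟩
    obtain ⟨m, C, hC, h⟩ := hM.bound n
    have h1 := (hy m).const_mul C
    rw [mul_zero] at h1
    refine squeeze_zero (fun _ => apply_nonneg _ _) (fun i => ?_) h1
    have h2 := h (L (u i) - y)
    rwa [map_sub, hLM] at h2

end GradedSpace

/-! ### Completeness of the sequence spaces `Σ(B)` -/

section expDec

variable {B : Type} [NormedAddCommGroup B] [NormedSpace ℝ B]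

theorem exp_mul_norm_le_seminorm (n k : ℕ) (f : expDec B) :
    Real.exp (n * k) * ‖f.1 k‖ ≤ (expDec B).seminorm n f :=
  (f.2 n).le_tsum k fun j _ => by positivity

theorem norm_le_seminorm (k : ℕ) (f : expDec B) : ‖f.1 k‖ ≤ (expDec B).seminorm 0 f := by
  simpa using exp_mul_norm_le_seminorm 0 k f

variable (B) in
-- The limit is taken entrywise. Bounding finite partial sums lets the Cauchy estimate pass to the
-- limit in `j`, which yields both membership of the limit and convergence in every seminorm.
theorem expDec_isFrechet [CompleteSpace B] : (expDec B).IsFrechet := by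
  refine ⟨fun x hx => Subtype.ext (funext fun k => ?_), fun u hu => ?_⟩
  · have := (norm_le_seminorm k x).trans (hx 0).le
    exact norm_le_zero_iff.1 this
  · have hc : ∀ k, ∃ y, Tendsto (fun i => (u i).1 k) atTop (𝓝 y) := fun k => by
      refine cauchySeq_tendsto_of_complete (Metric.cauchySeq_iff.2 fun ε hε => ?_)
      obtain ⟨N, hN⟩ := hu 0 ε hε
      refine ⟨N, fun i hi j hj => ?_⟩
      rw [dist_eq_norm]
      exact (norm_le_seminorm k (u i - u j)).trans_lt (hN i hi j hj)
    choose g hg using hc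
    have key : ∀ n : ℕ, ∀ ε > 0, ∃ N, ∀ i ≥ N, ∀ s : Finset ℕ,
        ∑ k ∈ s, Real.exp (n * k) * ‖(u i).1 k - g k‖ ≤ ε := fun n ε hε => by
      obtain ⟨N, hN⟩ := hu n ε hε
      refine ⟨N, fun i hi s => ?_⟩
      have ht : Tendsto (fun j => ∑ k ∈ s, Real.exp (n * k) * ‖(u i).1 k - (u j).1 k‖) atTop
          (𝓝 (∑ k ∈ s, Real.exp (n * k) * ‖(u i).1 k - g k‖)) :=
        tendsto_finsetSum _ fun k _ => ((tendsto_const_nhds.sub (hg k)).norm).const_mul _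
      refine le_of_tendsto ht ((eventually_ge_atTop N).mono fun j hj => ?_)
      exact (((u i - u j).2 n).sum_le_tsum s fun k _ => by positivity).trans (hN i hi j hj).le
    have hmem : g ∈ expDecSubmodule B := fun n => by
      obtain ⟨N, hN⟩ := key n 1 one_pos
      have h1 : Summable fun k : ℕ => Real.exp (n * k) * ‖(u N).1 k - g k‖ :=
        summable_of_sum_le (fun k => by positivity) (hN N le_rfl)
      refine Summable.of_nonneg_of_le (fun k => by positivity) (fun k => ?_) (((u N).2 n).add h1)
      rw [← mul_add]
      refine mul_le_mul_of_nonneg_left ?_ (Real.exp_pos _).le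
      calc ‖g k‖ = ‖(u N).1 k - ((u N).1 k - g k)‖ := by rw [sub_sub_cancel]
        _ ≤ _ := norm_sub_le _ _
    refine ⟨(⟨g, hmem⟩ : expDecSubmodule B), fun n => ?_⟩
    rw [Metric.tendsto_atTop]
    intro ε hε
    obtain ⟨N, hN⟩ := key n (ε / 2) (by positivity)
    refine ⟨N, fun i hi => ?_⟩
    rw [Real.dist_0_eq_abs, abs_of_nonneg (apply_nonneg _ _)]
    refine lt_of_le_of_lt ?_ (half_lt_self hε)
    exact Real.tsum_le_of_sum_le (fun k => by positivity) (hN i hi)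

variable (B) in
theorem GradedSpace.IsTameSummand.isTame [CompleteSpace B] {F : GradedSpace}
    (h : F.IsTameSummand (expDec B)) : F.IsTame :=
  ⟨h.isFrechet (expDec_isFrechet B), B, _, _, inferInstance, h⟩

end expDec

theorem GradedSpace.IsTameSummand.isTame_of_isTame {E F : GradedSpace} (h : E.IsTameSummand F)
    (hF : F.IsTame) : E.IsTame := by
  obtain ⟨hc, B, _, _, hB, hs⟩ := hF
  exact ⟨h.isFrechet hc, B, _, _, hB, h.trans hs⟩

/-- The real line, graded by the absolute value. -/
def realGraded : GradedSpace where
  carrier := ℝ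
  seminorm _ := normSeminorm ℝ ℝ
  mono := monotone_const

/-- The line sits in `Σ(ℝ)` as the sequences concentrated at index `0`, where every weight `e ^ (n ·
0)` equals `1`. -/
theorem realGraded_isTame : realGraded.IsTame := by
  refine GradedSpace.IsTameSummand.isTame ℝ ?_
  have hs : ∀ (n : ℕ) (x : ℝ), HasSum
      (fun k : ℕ => Real.exp (n * k) * ‖(Pi.single 0 x : ℕ → ℝ) k‖) ‖x‖ := fun n x => by
    have := hasSum_single (f := fun k : ℕ => Real.exp (n * k) * ‖(Pi.single 0 x : ℕ → ℝ) k‖) 0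
      fun k hk => by simp [Pi.single_eq_of_ne hk]
    simpa using this
  let L : ℝ →ₗ[ℝ] expDecSubmodule ℝ :=
    (LinearMap.single ℝ (fun _ : ℕ => ℝ) 0).codRestrict _ fun x n => (hs n x).summable
  let M : expDecSubmodule ℝ →ₗ[ℝ] ℝ :=
    LinearMap.proj (R := ℝ) (φ := fun _ : ℕ => ℝ) 0 ∘ₗ (expDecSubmodule ℝ).subtype
  refine ⟨(L : ℝ →ₗ[ℝ] expDecSubmodule ℝ), M, ⟨0, 0, fun _ => 1, fun n _ x => ?_⟩,
    ⟨0, 0, fun _ => 1, fun n _ x => ?_⟩, fun x => ?_⟩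
  · rw [one_mul]
    exact (hs n x).tsum_eq.le
  · rw [one_mul]
    exact (norm_le_seminorm 0 x).trans ((expDec ℝ).seminorm_le (Nat.zero_le _) x)
  · exact Pi.single_eq_same (M := fun _ : ℕ => ℝ) 0 x

/-! ### Hyperplanes in graded spaces -/

/-- The kernel of a linear functional, with the induced grading. -/
def GradedSpace.kernel (F : GradedSpace) (l : F →ₗ[ℝ] ℝ) : GradedSpace where
  carrier := LinearMap.ker l
  seminorm n := (F.seminorm n).comp (LinearMap.ker l).subtype
  mono := fun _ _ h x => F.mono h x.1

namespace GradedSpace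

variable {F : GradedSpace} {l : F →ₗ[ℝ] ℝ} {v : F}

/-- The projection onto the kernel of `l` along a vector `v` with `l v = 1`. -/
def kernelProj (l : F →ₗ[ℝ] ℝ) (v : F) (hv : l v = 1) : F →ₗ[ℝ] F.kernel l :=
  ((LinearMap.id : F →ₗ[ℝ] F) - l.smulRight v).codRestrict (LinearMap.ker l) fun x => by
    simp [hv]

theorem kernelProj_coe (hv : l v = 1) (x : F) :
    (LinearMap.ker l).subtype (kernelProj l v hv x) = x - l x • v := rfl

theorem isTameLinear_kernel_subtype (l : F →ₗ[ℝ] ℝ) :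
    IsTameLinear (E := F.kernel l) (F := F) (LinearMap.ker l).subtype :=
  ⟨0, 0, fun _ => 1, fun n _ x => by rw [one_mul]; exact le_rfl⟩

theorem isTameLinear_kernelProj (hv : l v = 1) {m : ℕ} {C : ℝ}
    (hl : ∀ x, ‖l x‖ ≤ C * F.seminorm m x) : IsTameLinear (kernelProj l v hv) := by
  -- The base degree is `m` because `l` is controlled only by the `m`-th seminorm and those above
  -- it.
  refine ⟨0, m, fun n => 1 + C * F.seminorm n v, fun n hn x => ?_⟩
  change F.seminorm n (x - l x • v) ≤ _
  refine (map_sub_le_add _ _ _).trans ?_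
  rw [map_smul_eq_mul, add_mul, one_mul, add_zero]
  have hC : C * F.seminorm m x ≤ |C| * F.seminorm n x :=
    mul_le_mul (le_abs_self C) (F.seminorm_le hn x) (apply_nonneg _ _) (abs_nonneg _)
  -- A negative `C` would contradict `1 = |l v| ≤ C ‖v‖ₘ`.
  have h0 : 0 ≤ C := by
    have h1 := hl v
    rw [hv, norm_one] at h1
    by_contra! h
    nlinarith [apply_nonneg (F.seminorm m) v]
  rw [abs_of_nonneg h0] at hC
  nlinarith [mul_le_mul_of_nonneg_right ((hl x).trans hC) (apply_nonneg (F.seminorm n) v)]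

theorem isTameSummand_kernel (hv : l v = 1) {m : ℕ} {C : ℝ}
    (hl : ∀ x, ‖l x‖ ≤ C * F.seminorm m x) : (F.kernel l).IsTameSummand F :=
  ⟨(LinearMap.ker l).subtype, kernelProj l v hv, isTameLinear_kernel_subtype l,
    isTameLinear_kernelProj hv hl, fun x => Subtype.ext (by
      change x.1 - l x.1 • v = x.1
      rw [LinearMap.mem_ker.1 x.2, zero_smul, sub_zero])⟩

end GradedSpace

open GradedSpace

/-! ### Calculus of smooth tame maps with Banach coefficients -/

theorem IsTameOn.mono {E F : GradedSpace} {P : E → F} {U U' : Set E} (h : IsTameOn P U)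
    (hU : U' ⊆ U) : IsTameOn P U' := by
  refine ⟨h.1.mono hU, fun x hx => ?_⟩
  obtain ⟨W, hW, r, b, C, hC⟩ := h.2 x (hU hx)
  exact ⟨W, hW, r, b, C, fun y hy => hC y ⟨hy.1, hU hy.2⟩⟩

theorem IsTameOn.add {E F : GradedSpace} {P Q : E → F} {U : Set E} (hP : IsTameOn P U)
    (hQ : IsTameOn Q U) : IsTameOn (fun x => P x + Q x) U := by
  refine ⟨hP.1.add hQ.1, fun x hx => ?_⟩
  obtain ⟨W, hW, r, b, C, hC⟩ := hP.2 x hx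
  obtain ⟨W', hW', r', b', C', hC'⟩ := hQ.2 x hx
  have aux : ∀ (y : E) (c : ℝ) (m m' : ℕ), m ≤ m' →
      c * (1 + E.seminorm m y) ≤ |c| * (1 + E.seminorm m' y) := fun y c m m' h =>
    mul_le_mul (le_abs_self c) (by linarith [E.seminorm_le h y])
      (by linarith [apply_nonneg (E.seminorm m) y]) (abs_nonneg c)
  refine ⟨W ∩ W', inter_mem hW hW', r + r', max b b', fun n => |C n| + |C' n|,
    fun y hy n hn => ?_⟩
  rw [add_mul]
  exact (map_add_le_add _ _ _).trans (add_le_add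
    ((hC y ⟨hy.1.1, hy.2⟩ n (le_of_max_le_left hn)).trans (aux y _ _ _ (by omega)))
    ((hC' y ⟨hy.1.2, hy.2⟩ n (le_of_max_le_right hn)).trans (aux y _ _ _ (by omega))))

theorem IsSmoothTameOn.mono {E F : GradedSpace} {P : E → F} {U U' : Set E}
    (h : IsSmoothTameOn P U) (hU : U' ⊆ U) : IsSmoothTameOn P U' := by
  obtain ⟨D, h0, h1, h2⟩ := h
  exact ⟨D, fun x hx => h0 x (hU hx), fun k x hx => h1 k x (hU hx),
    fun k => (h2 k).mono fun z hz => hU hz⟩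

theorem IsSmoothTameOn.congr {E F : GradedSpace} {P Q : E → F} {U : Set E}
    (h : IsSmoothTameOn P U) (hPQ : EqOn Q P U) : IsSmoothTameOn Q U := by
  obtain ⟨D, h0, h1, h2⟩ := h
  exact ⟨D, fun x hx h => (h0 x hx h).trans (hPQ hx).symm, h1, h2⟩

theorem IsSmoothTameOn.continuousOn {E F : GradedSpace} {P : E → F} {U : Set E}
    (h : IsSmoothTameOn P U) : ContinuousOn P U := by
  obtain ⟨D, h0, -, h2⟩ := h
  -- Only joint continuity of `D 0` is given; it is restricted to the slice of the empty tuple of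
  -- directions.
  have h3 := (h2 0).1.comp
    (isTameLinear_inl E (E.pow 0)).continuous.continuousOn (s := U) fun x hx => hx
  exact h3.congr fun x hx => (h0 x hx 0).symm

/-! ### Symbols: smooth functions of Banach data times tame affine maps -/

section Symbol

variable {E F : GradedSpace} {X : Type*} [NormedAddCommGroup X] [NormedSpace ℝ X]

/-- The map induced by `T` on a base point and `k` directions. -/
def symbolMap (T : E →ₗ[ℝ] X) (k : ℕ) (z : E.prod (E.pow k)) : X × (Fin k → X) :=
  (T (Prod.fst z), fun i => T (Prod.snd z i))

theorem continuous_symbolMap {T : E →ₗ[ℝ] X} (hT : Continuous T) (k : ℕ) :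
    Continuous (symbolMap T k) :=
  (hT.comp (isTameLinear_fst E (E.pow k)).continuous).prodMk (continuous_pi fun i =>
    hT.comp ((isTameLinear_proj E i).continuous.comp (isTameLinear_snd E (E.pow k)).continuous))

/-- Finite sums of maps `(x, h) ↦ g (T x, T h₁, …, T hₖ) • (a (x, h) + b)`, where `g` is a smooth
function on a normed space and `a` is a tame linear map. -/
inductive IsSymbol (T : E →ₗ[ℝ] X) (Ω : Set X) (k : ℕ) : (E.prod (E.pow k) → F) → Prop
  | term (g : X × (Fin k → X) → ℝ) (hg : ContDiffOn ℝ ∞ g (Ω ×ˢ univ))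
      (a : E.prod (E.pow k) →ₗ[ℝ] F) (ha : IsTameLinear a) (b : F) :
      IsSymbol T Ω k (fun z => g (symbolMap T k z) • (a z + b))
  | add {P Q : E.prod (E.pow k) → F} (hP : IsSymbol T Ω k P) (hQ : IsSymbol T Ω k Q) :
      IsSymbol T Ω k (fun z => P z + Q z)

variable {T : E →ₗ[ℝ] X} {Ω : Set X} {k : ℕ}

/-- The scalar factor depends continuously on the point, so near each point it is bounded by a
constant `K` independent of the degree. All dependence on the degree then comes from the tame affine
factor. -/
theorem IsSymbol.isTameOn (hT : Continuous T) (hΩ : IsOpen Ω) {Q : E.prod (E.pow k) → F}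
    (hQ : IsSymbol T Ω k Q) : IsTameOn Q {z | T (Prod.fst z) ∈ Ω} := by
  induction hQ with
  | add _ _ hP hQ => exact hP.add hQ
  | term g hg a ha b =>
    have hgc : ∀ z : E.prod (E.pow k), T (Prod.fst z) ∈ Ω →
        ContinuousAt (fun z => g (symbolMap T k z)) z := fun z hz =>
      ContinuousAt.comp (hg.continuousOn.continuousAt
        ((hΩ.prod isOpen_univ).mem_nhds ⟨hz, mem_univ _⟩)) (continuous_symbolMap hT k).continuousAt
    refine ⟨fun z hz => ((hgc z hz).smul
      (ha.continuous.add continuous_const).continuousAt).continuousWithinAt, fun z hz => ?_⟩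
    obtain ⟨r, c, C, hC, h⟩ := ha.exists_nonneg
    have hW := (hgc z hz).norm.eventually_lt_const (lt_add_one ‖g (symbolMap T k z)‖)
    set K := ‖g (symbolMap T k z)‖ + 1
    refine ⟨_, hW, r, c, fun n => K * (C n + F.seminorm n b), fun y hy n hn => ?_⟩
    rw [map_smul_eq_mul, mul_assoc]
    refine mul_le_mul (le_of_lt hy.1) ?_ (apply_nonneg _ _) (by positivity)
    have h1 := map_add_le_add (F.seminorm n) (a y) b
    have h2 := h n hn y
    have h3 : 0 ≤ (E.prod (E.pow k)).seminorm (n + r) y := apply_nonneg _ _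
    have h4 : 0 ≤ F.seminorm n b := apply_nonneg _ _
    nlinarith [hC n]

/-- Forgetting the last direction. -/
def initDirections (E : GradedSpace) (k : ℕ) : E.prod (E.pow (k + 1)) →ₗ[ℝ] E.prod (E.pow k) :=
  LinearMap.prodMap (LinearMap.id : E →ₗ[ℝ] E)
    (LinearMap.funLeft ℝ E (Fin.castSucc : Fin k → Fin (k + 1)))

theorem isTameLinear_initDirections (E : GradedSpace) (k : ℕ) :
    IsTameLinear (initDirections E k) := by
  refine ⟨0, 0, fun _ => 1, fun n _ z => ?_⟩
  rw [one_mul]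
  refine add_le_add (le_refl (E.seminorm n (Prod.fst z))) ?_
  refine (pow_seminorm_apply E k n fun i => Prod.snd z i.castSucc).trans_le
    (le_trans ?_ (pow_seminorm_apply E (k + 1) n (Prod.snd z)).ge)
  rw [Fin.sum_univ_castSucc]
  exact le_add_of_nonneg_right (apply_nonneg (E.seminorm n) _)

/-- The last direction, considered as a variation of the base point. -/
def lastDirection (E : GradedSpace) (k : ℕ) : E.prod (E.pow (k + 1)) →ₗ[ℝ] E.prod (E.pow k) :=
  (LinearMap.inl ℝ E (E.pow k) : E →ₗ[ℝ] E.prod (E.pow k)) ∘ₗ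
    ((LinearMap.proj (R := ℝ) (φ := fun _ => (E : Type)) (Fin.last k) :
      E.pow (k + 1) →ₗ[ℝ] E) ∘ₗ
      (LinearMap.snd ℝ E (E.pow (k + 1)) : E.prod (E.pow (k + 1)) →ₗ[ℝ] E.pow (k + 1)))

theorem isTameLinear_lastDirection (E : GradedSpace) (k : ℕ) :
    IsTameLinear (lastDirection E k) :=
  (isTameLinear_inl E (E.pow k)).comp
    ((isTameLinear_proj E (Fin.last k)).comp (isTameLinear_snd E (E.pow (k + 1))))

/-- Product rule: varying the base point along `v` turns `g • (a z + b)` into `Dg (T v, 0) • (a z +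
b) + g • a (v, 0)`. Both terms are symbols with one more direction, because `T v` is part of the
enlarged Banach data and `v` enters the second tame factor linearly. -/
theorem IsSymbol.exists_deriv (hΩ : IsOpen Ω) {Q : E.prod (E.pow k) → F}
    (hQ : IsSymbol T Ω k Q) : ∃ Q' : E.prod (E.pow (k + 1)) → F, IsSymbol T Ω (k + 1) Q' ∧
      ∀ x, T x ∈ Ω → ∀ (h : Fin k → E) (v : E),
        Tendsto (fun t : ℝ => t⁻¹ • (Q (x + t • v, h) - Q (x, h))) (𝓝[≠] 0)
          (𝓝 (Q' (x, Fin.snoc (α := fun _ => E) h v))) := by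
  induction hQ with
  | add _ _ hP hQ =>
    obtain ⟨P', hP', h1⟩ := hP
    obtain ⟨Q', hQ', h2⟩ := hQ
    refine ⟨_, hP'.add hQ', fun x hx h v => ((h1 x hx h v).add (h2 x hx h v)).congr fun t => ?_⟩
    rw [← smul_add, add_sub_add_comm]
  | term g hg a ha b =>
    have hopen : IsOpen (Ω ×ˢ (univ : Set (Fin k → X))) := hΩ.prod isOpen_univ
    -- `r` and `d` are the Banach-side shadows of `initDirections` and `lastDirection`: the old
    -- point, and the variation of its base component.
    let r : X × (Fin (k + 1) → X) →L[ℝ] X × (Fin k → X) :=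
      (ContinuousLinearMap.fst ℝ X (Fin (k + 1) → X)).prod (ContinuousLinearMap.pi fun i =>
        (ContinuousLinearMap.proj (R := ℝ) (φ := fun _ => X) i.castSucc).comp
          (ContinuousLinearMap.snd ℝ X (Fin (k + 1) → X)))
    let d : X × (Fin (k + 1) → X) →L[ℝ] X × (Fin k → X) :=
      ((ContinuousLinearMap.proj (R := ℝ) (φ := fun _ => X) (Fin.last k)).comp
          (ContinuousLinearMap.snd ℝ X (Fin (k + 1) → X))).prod 0
    have hmaps : MapsTo r (Ω ×ˢ univ) (Ω ×ˢ univ) := fun y hy => ⟨hy.1, mem_univ _⟩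
    have hg1 : ContDiffOn ℝ ∞ (fun y => fderiv ℝ g (r y) (d y)) (Ω ×ˢ univ) :=
      ((hg.fderiv_of_isOpen hopen (m := ∞) (by simp)).comp r.contDiff.contDiffOn hmaps).clm_apply
        d.contDiff.contDiffOn
    have hg2 : ContDiffOn ℝ ∞ (fun y => g (r y)) (Ω ×ˢ univ) :=
      hg.comp r.contDiff.contDiffOn hmaps
    refine ⟨_, (IsSymbol.term _ hg1 _ (ha.comp (isTameLinear_initDirections E k)) b).add
      (IsSymbol.term _ hg2 _ (ha.comp (isTameLinear_lastDirection E k)) 0), fun x hx h v => ?_⟩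
    set z : E.prod (E.pow k) := (x, h)
    set w : E.prod (E.pow k) := (v, 0)
    set z' : E.prod (E.pow (k + 1)) := (x, Fin.snoc (α := fun _ => E) h v)
    have e1 : r (symbolMap T (k + 1) z') = symbolMap T k z := by
      refine Prod.ext rfl (funext fun i => ?_)
      exact congrArg T (Fin.snoc_castSucc (α := fun _ => (E : Type)) v h i)
    have e2 : d (symbolMap T (k + 1) z') = (T v, 0) :=
      Prod.ext (congrArg T (Fin.snoc_last (α := fun _ => (E : Type)) v h)) rfl
    have e3 : initDirections E k z' = z :=
      Prod.ext rfl (funext fun i => Fin.snoc_castSucc (α := fun _ => (E : Type)) v h i)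
    have e4 : lastDirection E k z' = w :=
      Prod.ext (Fin.snoc_last (α := fun _ => (E : Type)) v h) rfl
    have e5 : ∀ t : ℝ, ((x + t • v, h) : E × (Fin k → E)) = z + t • w := fun t =>
      Prod.ext rfl (by change h = h + t • 0; simp)
    have e6 : ∀ t : ℝ, symbolMap T k (z + t • w) = symbolMap T k z + t • (T v, 0) := fun t => by
      refine Prod.ext ?_ (funext fun i => ?_)
      · change T (x + t • v) = T x + t • T v
        simp
      · change T (h i + t • (0 : E)) = T (h i) + t • 0
        simp
    simp only [LinearMap.comp_apply, e1, e2, e3, e4, add_zero]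
    have hd : HasFDerivAt g (fderiv ℝ g (symbolMap T k z)) (symbolMap T k z) :=
      ((hg.contDiffAt (hopen.mem_nhds ⟨hx, mem_univ _⟩)).differentiableAt
        (by simp)).hasFDerivAt
    have hl := hasDerivAt_iff_tendsto_slope_zero.1 (hd.hasLineDerivAt (T v, 0))
    have ht : Tendsto (fun t : ℝ => t) (𝓝[≠] 0) (𝓝 0) := tendsto_id.mono_left nhdsWithin_le_nhds
    have hA : Tendsto (fun t : ℝ => a z + b + t • a w) (𝓝[≠] 0) (𝓝 (a z + b)) := by
      simpa using tendsto_const_nhds.add (ht.smul_const (a w))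
    -- For `t ≠ 0` the difference quotient is exactly the slope of `g` times `a z + b + t • a w`,
    -- plus the fixed vector `g • a w`.
    refine Tendsto.congr' ?_ ((hl.smul hA).add_const (g (symbolMap T k z) • a w))
    filter_upwards [self_mem_nhdsWithin] with t ht0
    change _ = t⁻¹ • (g (symbolMap T k ((x + t • v, h) : E × (Fin k → E))) •
      (a ((x + t • v, h) : E × (Fin k → E)) + b) - g (symbolMap T k z) • (a z + b))
    rw [e5, e6, map_add, map_smul]
    have ht1 : t⁻¹ * t = 1 := inv_mul_cancel₀ ht0
    simp only [zero_add, zero_smul, add_zero, smul_eq_mul]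
    have : g (symbolMap T k z) • a w = (t⁻¹ * t) • (g (symbolMap T k z) • a w) := by
      rw [ht1, one_smul]
    rw [this]
    module

theorem IsSymbol.isSmoothTameOn (hT : Continuous T) (hΩ : IsOpen Ω) {P : E → F}
    (hP : IsSymbol T Ω 0 (fun z : E.prod (E.pow 0) => P (Prod.fst z))) :
    IsSmoothTameOn P {x | T x ∈ Ω} := by
  choose δ hδ hδ' using
    fun (k : ℕ) (Q : {Q : E.prod (E.pow k) → F // IsSymbol T Ω k Q}) => Q.2.exists_deriv hΩ
  -- The recursion must carry the proof of being a symbol, since the next derivative is chosen from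
  -- it.
  let D : (k : ℕ) → {Q : E.prod (E.pow k) → F // IsSymbol T Ω k Q} :=
    fun k => Nat.rec ⟨_, hP⟩ (fun k Q => ⟨δ k Q, hδ k Q⟩) k
  exact ⟨fun k => (D k).1, fun x _ h => rfl, fun k x hx => hδ' k (D k) x hx,
    fun k => (D k).2.isTameOn hT hΩ⟩

/-- A map `x ↦ g (T x) • (a x + b)` is the restriction of a symbol. -/
theorem isSymbol_zero {g : X → ℝ} (hg : ContDiffOn ℝ ∞ g Ω) {a : E →ₗ[ℝ] F}
    (ha : IsTameLinear a) (b : F) : IsSymbol T Ω 0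
      (fun z : E.prod (E.pow 0) => g (T (Prod.fst z)) • (a (Prod.fst z) + b)) :=
  IsSymbol.term (fun y => g y.1) (hg.comp contDiff_fst.contDiffOn fun _ hy => hy.1) _
    (ha.comp (isTameLinear_fst E (E.pow 0))) b

end Symbol

theorem isSmoothTameOn_id (E : GradedSpace) (U : Set E) : IsSmoothTameOn (id : E → E) U := by
  have h := (isSymbol_zero (T := (0 : E →ₗ[ℝ] ℝ)) (Ω := univ) (g := fun _ => 1)
    contDiffOn_const (isTameLinear_id E) 0).isSmoothTameOn (P := fun x => (1 : ℝ) • (x + 0))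
    continuous_const isOpen_univ
  exact (h.mono (subset_univ U)).congr fun x _ => by simp

/-! ### Level sets of homogeneous functions -/

/-- A chart straightening the level set `N (T x) = 1` of a positively homogeneous smooth positive
function `N` on an open cone of a normed space, near a point `p` with `m (T p) = 1`:
`x ↦ (x / m (T x) - p, N (T x) - 1)`. -/
theorem exists_chart_of_homogeneous {F : GradedSpace} {X : Type*} [NormedAddCommGroup X]
    [NormedSpace ℝ X] (T : F →ₗ[ℝ] X) {n : ℕ} {C : ℝ} (hT : ∀ x, ‖T x‖ ≤ C * F.seminorm n x)
    {Ω : Set X} (hΩ : IsOpen Ω) (hcone : ∀ y ∈ Ω, ∀ t : ℝ, 0 < t → t • y ∈ Ω) {N : X → ℝ}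
    (hN : ContDiffOn ℝ ∞ N Ω) (hpos : ∀ y ∈ Ω, 0 < N y)
    (hhom : ∀ y, ∀ t : ℝ, 0 < t → N (t • y) = t * N y) (m : X →L[ℝ] ℝ) (p : F)
    (hp : m (T p) = 1) :
    ∃ ψ : OpenPartialHomeomorph F ((F.kernel (m.toLinearMap ∘ₗ T)).prod realGraded),
      ψ.source = {x | T x ∈ Ω ∧ 0 < m (T x)} ∧ IsSmoothTameOn ψ ψ.source ∧
      IsSmoothTameOn ψ.symm ψ.target ∧ ∀ x, @Eq ℝ (Prod.snd (ψ x)) (N (T x) - 1) := by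
  set l : F →ₗ[ℝ] ℝ := m.toLinearMap ∘ₗ T
  have hlp : l p = 1 := hp
  have hl : ∀ x, ‖l x‖ ≤ ‖m‖ * C * F.seminorm n x := fun x => by
    rw [mul_assoc]
    exact (m.le_opNorm _).trans (mul_le_mul_of_nonneg_left (hT x) (norm_nonneg m))
  have hTc : Continuous T := continuous_of_norm_bound T hT
  let G := (F.kernel l).prod realGraded
  let ι : F.kernel l →ₗ[ℝ] F := (LinearMap.ker l).subtype
  have hι : IsTameLinear ι := isTameLinear_kernel_subtype l
  have hιl : ∀ e, l (ι e) = 0 := fun e => LinearMap.mem_ker.1 e.2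
  let π : F →ₗ[ℝ] F.kernel l := kernelProj l p hlp
  have hπ : IsTameLinear π := isTameLinear_kernelProj hlp hl
  have hπι : ∀ x, ι (π x) = x - l x • p := kernelProj_coe hlp
  have hι_inj : Function.Injective ι := Subtype.val_injective
  let q : G →ₗ[ℝ] ℝ := (LinearMap.snd ℝ (F.kernel l) realGraded : G →ₗ[ℝ] realGraded)
  let ν : F.kernel l →ₗ[ℝ] G := LinearMap.inl ℝ (F.kernel l) realGraded
  have hν : IsTameLinear ν := isTameLinear_inl _ realGraded
  let u₁ : G := ((0, 1) : F.kernel l × ℝ)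
  let f : F → G := fun x => ((l x)⁻¹ • π x, (N (T x) - 1 : ℝ))
  -- The inverse: by homogeneity this multiple is the point of the ray through `e + p` at which `N ∘
  -- T` takes the value `1 + q`.
  let g : G → F := fun z => ((1 + q z) * (N (T (ι (Prod.fst z)) + T p))⁻¹) •
    (ι (Prod.fst z) + p)
  let S : Set F := {x | T x ∈ Ω ∧ 0 < l x}
  let R : Set G := {z | T (ι (Prod.fst z)) + T p ∈ Ω ∧ -1 < q z}
  have hSo : IsOpen (Ω ∩ {y | 0 < m y}) :=
    hΩ.inter (isOpen_lt continuous_const m.continuous)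
  have hf : IsSmoothTameOn f S := by
    -- The two components of `f` are separate symbols: a scalar times the tame projection, and a
    -- scalar times the constant vector `u₁`.
    have s1 := isSymbol_zero (T := T) (F := G) (Ω := Ω ∩ {y | 0 < m y}) (g := fun y => (m y)⁻¹)
      (m.contDiff.contDiffOn.inv fun y hy => hy.2.ne') (hν.comp hπ) 0
    have s2 := isSymbol_zero (T := T) (F := G) (Ω := Ω ∩ {y | 0 < m y}) (g := fun y => N y - 1)
      ((hN.mono inter_subset_left).sub contDiffOn_const) (isTameLinear_zero F G)
      u₁
    refine ((s1.add s2).isSmoothTameOn (P := fun x => (m (T x))⁻¹ •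
      ((ν ∘ₗ π) x + 0) +
      (N (T x) - 1) • ((0 : F →ₗ[ℝ] G) x + u₁)) hTc hSo).congr ?_
    intro x _
    refine Prod.ext ?_ ?_
    · change (l x)⁻¹ • π x = (l x)⁻¹ • (π x + 0) + (N (T x) - 1) • (0 + 0)
      simp
    · change N (T x) - 1 = (l x)⁻¹ • ((0 : ℝ) + 0) + (N (T x) - 1) • ((0 : ℝ) + 1)
      simp
  -- The scalar factor of `g` depends also on the real coordinate, so that coordinate joins the
  -- Banach data.
  let T' : G →ₗ[ℝ] X × ℝ := LinearMap.prodMap (T ∘ₗ ι) (LinearMap.id : ℝ →ₗ[ℝ] ℝ)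
  have hT'c : Continuous T' := by
    refine (hTc.comp (hι.continuous.comp (isTameLinear_fst _ realGraded).continuous)).prodMk ?_
    exact continuous_of_norm_bound (m := 0) (C := 1)
      q fun x => by
        rw [one_mul]
        exact le_add_of_nonneg_left (apply_nonneg ((F.kernel l).seminorm 0) _)
  let Ω' : Set (X × ℝ) := {y | y.1 + T p ∈ Ω ∧ -1 < y.2}
  have hΩ' : IsOpen Ω' := (hΩ.preimage (continuous_fst.add continuous_const)).inter
    (isOpen_lt continuous_const continuous_snd)
  have hg : IsSmoothTameOn g R := by
    have hN' : ContDiffOn ℝ ∞ (fun y : X × ℝ => N (y.1 + T p)) Ω' :=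
      hN.comp (contDiff_fst.add contDiff_const).contDiffOn fun y hy => hy.1
    have s := isSymbol_zero (T := T') (F := F) (Ω := Ω')
      (g := fun y => (1 + y.2) * (N (y.1 + T p))⁻¹)
      ((contDiff_const.add contDiff_snd).contDiffOn.mul (hN'.inv fun y hy => (hpos _ hy.1).ne'))
      (hι.comp (isTameLinear_fst _ realGraded)) p
    exact s.isSmoothTameOn (P := g) hT'c hΩ'
  have hgT : ∀ z, T (g z) = ((1 + q z) *
      (N (T (ι (Prod.fst z)) + T p))⁻¹) • (T (ι (Prod.fst z)) + T p) := fun z => by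
    simp only [g, map_smul, map_add]
  have hgl : ∀ z, l (g z) = (1 + q z) *
      (N (T (ι (Prod.fst z)) + T p))⁻¹ := fun z => by
    simp only [g, map_smul, map_add, hιl, hlp, zero_add, smul_eq_mul, mul_one]
  have hc : ∀ z ∈ R, 0 < (1 + q z) * (N (T (ι (Prod.fst z)) + T p))⁻¹ :=
    fun z hz => mul_pos (by linarith [hz.2]) (inv_pos.2 (hpos _ hz.1))
  -- Adding `p` back to the first coordinate gives the point where the ray through `x` meets `l =
  -- 1`; both inverse identities rest on this.
  have hfι : ∀ x ∈ S, ι ((l x)⁻¹ • π x) + p = (l x)⁻¹ • x := fun x hx => by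
    rw [map_smul, hπι, smul_sub, smul_smul, inv_mul_cancel₀ hx.2.ne', one_smul, sub_add_cancel]
  have hmapf : ∀ x ∈ S, f x ∈ R := fun x hx => by
    refine ⟨?_, ?_⟩
    · change T (ι ((l x)⁻¹ • π x)) + T p ∈ Ω
      rw [← map_add, hfι x hx, map_smul]
      exact hcone _ hx.1 _ (inv_pos.2 hx.2)
    · change -1 < N (T x) - 1
      linarith [hpos _ hx.1]
  have hmapg : ∀ z ∈ R, g z ∈ S := fun z hz => by
    refine ⟨?_, ?_⟩
    · rw [hgT]
      exact hcone _ hz.1 _ (hc z hz)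
    · rw [hgl]
      exact hc z hz
  have hgf : ∀ x ∈ S, g (f x) = x := fun x hx => by
    change ((1 + (N (T x) - 1)) * (N (T (ι ((l x)⁻¹ • π x)) + T p))⁻¹) •
      (ι ((l x)⁻¹ • π x) + p) = x
    rw [← map_add, hfι x hx, map_smul, hhom _ _ (inv_pos.2 hx.2), smul_smul]
    have h1 := hx.2.ne'
    have h2 := (hpos _ hx.1).ne'
    have : (1 + (N (T x) - 1)) * ((l x)⁻¹ * N (T x))⁻¹ * (l x)⁻¹ = 1 := by field_simp; ring
    rw [this, one_smul]
  have hfg : ∀ z ∈ R, f (g z) = z := fun z hz => by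
    have h1 := (hc z hz).ne'
    refine Prod.ext (hι_inj ?_) ?_
    · change ι ((l (g z))⁻¹ • π (g z)) = ι (Prod.fst z)
      rw [← add_left_inj p, hfι _ (hmapg z hz), hgl]
      simp only [g, smul_smul, inv_mul_cancel₀ h1, one_smul]
    · change N (T (g z)) - 1 = q z
      rw [hgT, hhom _ _ (hc z hz), mul_assoc, inv_mul_cancel₀ (hpos _ hz.1).ne']
      ring
  exact ⟨{ toFun := f
           invFun := g
           source := S
           target := R
           map_source' := hmapf
           map_target' := hmapg
           left_inv' := hgf
           right_inv' := hfg
           open_source := hSo.preimage hTc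
           open_target := hΩ'.preimage hT'c
           continuousOn_toFun := hf.continuousOn
           continuousOn_invFun := hg.continuousOn }, rfl, hf, hg, fun _ => rfl⟩

/-! ### The length functional -/

section Sqrt

variable {K : Type*} [TopologicalSpace K] [CompactSpace K]

/-- Squaring, as a homeomorphism of the open set of positive functions. -/
def squareHomeomorph (K : Type*) [TopologicalSpace K] [CompactSpace K] :
    OpenPartialHomeomorph C(K, ℝ) C(K, ℝ) where
  toFun f := f * f
  invFun f := (⟨Real.sqrt, Real.continuous_sqrt⟩ : C(ℝ, ℝ)).comp f
  source := {f | ∀ s, 0 < f s}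
  target := {f | ∀ s, 0 < f s}
  map_source' _ hf s := mul_pos (hf s) (hf s)
  map_target' _ hf s := Real.sqrt_pos.2 (hf s)
  left_inv' _ hf := ContinuousMap.ext fun s => Real.sqrt_mul_self (hf s).le
  right_inv' _ hf := ContinuousMap.ext fun s => Real.mul_self_sqrt (hf s).le
  open_source := by
    simpa [MapsTo] using ContinuousMap.isOpen_setOfPred_mapsTo (isCompact_univ (X := K))
      (isOpen_Ioi (a := (0 : ℝ)))
  open_target := by
    simpa [MapsTo] using ContinuousMap.isOpen_setOfPred_mapsTo (isCompact_univ (X := K))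
      (isOpen_Ioi (a := (0 : ℝ)))
  continuousOn_toFun := (continuous_id.mul continuous_id).continuousOn
  continuousOn_invFun := (ContinuousMap.continuous_postcomp _).continuousOn

/-- The map inverts the squaring homeomorphism, whose derivative at a positive `y` is multiplication
by `2y`, invertible with inverse multiplication by `(2y)⁻¹`. Hence the inverse is smooth. -/
theorem contDiffOn_sqrt_comp :
    ContDiffOn ℝ ∞ (fun f : C(K, ℝ) => (⟨Real.sqrt, Real.continuous_sqrt⟩ : C(ℝ, ℝ)).comp f)
      {f | ∀ s, 0 < f s} := by
  intro f hf
  set e := squareHomeomorph K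
  have hy : ∀ s, 0 < e.symm f s := e.map_target hf
  set y : C(K, ℝ) := e.symm f
  let u : C(K, ℝ) := ⟨fun s => (2 * y s)⁻¹,
    (continuous_const.mul y.continuous).inv₀ fun s => (mul_pos two_pos (hy s)).ne'⟩
  let D : C(K, ℝ) ≃L[ℝ] C(K, ℝ) := ContinuousLinearEquiv.equivOfInverse
    (ContinuousLinearMap.mul ℝ C(K, ℝ) (y + y)) (ContinuousLinearMap.mul ℝ C(K, ℝ) u)
    (fun h => ContinuousMap.ext fun s => by
      have := (hy s).ne'
      change (2 * y s)⁻¹ * ((y s + y s) * h s) = h s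
      field_simp
      ring)
    (fun h => ContinuousMap.ext fun s => by
      have := (hy s).ne'
      change (y s + y s) * ((2 * y s)⁻¹ * h s) = h s
      field_simp
      ring)
  have hd : HasFDerivAt e (D : C(K, ℝ) →L[ℝ] C(K, ℝ)) y := by
    refine ((hasFDerivAt_id y).mul (hasFDerivAt_id y)).congr_fderiv ?_
    ext h s
    change y s * h s + y s * h s = (y s + y s) * h s
    ring
  exact (e.contDiffAt_symm hf hd (contDiff_id.mul contDiff_id).contDiffAt).contDiffWithinAt

end Sqrt

/-- The integral on the unit interval of the norm of a continuous function. -/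
def normIntegral (y : C(unitInterval, Plane)) : ℝ := ∫ s, ‖y s‖

/-- The nowhere vanishing continuous functions. -/
def nonvanishing : Set C(unitInterval, Plane) := {y | ∀ s, y s ≠ 0}

theorem isOpen_nonvanishing : IsOpen nonvanishing := by
  have h := ContinuousMap.isOpen_setOfPred_mapsTo (isCompact_univ (X := unitInterval))
    (isOpen_compl_singleton (x := (0 : Plane)))
  have : nonvanishing = {f : C(unitInterval, Plane) | MapsTo f univ {(0 : Plane)}ᶜ} :=
    Set.ext fun f => ⟨fun hf s _ => hf s, fun hf s => hf (mem_univ s)⟩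
  rw [this]
  exact h

theorem integrable_continuousMap {V : Type*} [NormedAddCommGroup V] (y : C(unitInterval, V)) :
    Integrable y (volume : Measure unitInterval) := by
  rw [← integrableOn_univ]
  exact y.continuous.continuousOn.integrableOn_compact isCompact_univ

theorem normIntegral_pos {y : C(unitInterval, Plane)} (hy : y ∈ nonvanishing) :
    0 < normIntegral y := by
  rw [normIntegral, integral_pos_iff_support_of_nonneg (fun s => norm_nonneg _)
    (integrable_continuousMap y).norm]
  have : Function.support (fun s => ‖y s‖) = univ :=
    eq_univ_of_forall fun s => norm_ne_zero_iff.2 (hy s)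
  rw [this]
  simp

/-- The functional is a composite: the quadratic map `y₀² + y₁²`, positive where `y` does not
vanish, then the pointwise square root, then the continuous linear integral. -/
theorem contDiffOn_normIntegral : ContDiffOn ℝ ∞ normIntegral nonvanishing := by
  let c : Fin 2 → C(unitInterval, Plane) →L[ℝ] C(unitInterval, ℝ) := fun i =>
    (EuclideanSpace.proj (𝕜 := ℝ) i).compLeftContinuous ℝ unitInterval
  let J : C(unitInterval, ℝ) →L[ℝ] ℝ := LinearMap.mkContinuous
    { toFun := fun f => ∫ s, f s
      map_add' := fun f g => integral_add (integrable_continuousMap f) (integrable_continuousMap g)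
      map_smul' := fun a f => integral_const_mul a _ } 1 fun f => by
    have := norm_integral_le_of_norm_le_const (μ := (volume : Measure unitInterval))
      (Eventually.of_forall fun s => f.norm_coe_le_norm s)
    simpa using this
  have h : ContDiffOn ℝ ∞ (fun y => J ((⟨Real.sqrt, Real.continuous_sqrt⟩ : C(ℝ, ℝ)).comp
      (c 0 y * c 0 y + c 1 y * c 1 y))) nonvanishing := by
    refine J.contDiff.comp_contDiffOn (contDiffOn_sqrt_comp.comp
      (((c 0).contDiff.mul (c 0).contDiff).add
        ((c 1).contDiff.mul (c 1).contDiff)).contDiffOn fun y hy s => ?_)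
    have h1 : 0 < ‖y s‖ := norm_pos_iff.2 (hy s)
    rw [EuclideanSpace.norm_eq, Real.sqrt_pos, Fin.sum_univ_two] at h1
    have h2 : 0 < y s 0 * y s 0 + y s 1 * y s 1 := by simpa [sq] using h1
    exact h2
  refine h.congr fun y hy => ?_
  refine integral_congr_ae (Eventually.of_forall fun s => ?_)
  change ‖y s‖ = Real.sqrt (y s 0 * y s 0 + y s 1 * y s 1)
  rw [EuclideanSpace.norm_eq, Fin.sum_univ_two]
  simp [sq]

theorem normIntegral_smul (y : C(unitInterval, Plane)) (t : ℝ) (ht : 0 < t) :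
    normIntegral (t • y) = t * normIntegral y := by
  simp only [normIntegral, ContinuousMap.smul_apply, norm_smul, Real.norm_of_nonneg ht.le,
    integral_const_mul]

/-! ### The manifold of immersions and the submanifold of length-one immersions -/

theorem norm_derivMod_le {I : Domain} {V : Type} [NormedAddCommGroup V] [NormedSpace ℝ V]
    {j k : ℕ} (h : j < k) (γ : curveGraded I V) (s : unitInterval) :
    ‖derivMod I V j γ s‖ ≤ (curveGraded I V).seminorm k γ :=
  (le_ciSup (derivMod_bddAbove I V j γ) s).trans
    (Finset.single_le_sum (f := fun j => ⨆ s, ‖derivMod I V j γ s‖)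
      (fun _ _ => Real.iSup_nonneg fun _ => norm_nonneg _) (Finset.mem_range.2 h))

/-- The derivative of a curve modulo translations, as a continuous function. -/
def velocity (I : Domain) : curveGraded I Plane →ₗ[ℝ] C(unitInterval, Plane) where
  toFun γ := ⟨derivMod I Plane 0 γ, derivMod_continuous I Plane 0 γ⟩
  map_add' γ η := ContinuousMap.ext fun s => congrFun (map_add (derivMod I Plane 0) γ η) s
  map_smul' c γ := ContinuousMap.ext fun s => congrFun (map_smul (derivMod I Plane 0) c γ) s

theorem norm_velocity_le (I : Domain) (γ : curveGraded I Plane) :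
    ‖velocity I γ‖ ≤ 1 * (curveGraded I Plane).seminorm 1 γ := by
  rw [one_mul, ContinuousMap.norm_le _ (apply_nonneg _ _)]
  exact fun s => norm_derivMod_le one_pos γ s

theorem continuous_velocity (I : Domain) : Continuous (velocity I) :=
  continuous_of_norm_bound _ (norm_velocity_le I)

theorem immersionChart_symm_apply (I : Domain) {γ : curveGraded I Plane}
    (hγ : γ ∈ immersions I) :
    (((immersions I).openPartialHomeomorphSubtypeCoe (nonempty_immersions I)).symm γ).1 = γ :=
  ((immersions I).openPartialHomeomorphSubtypeCoe (nonempty_immersions I)).right_inv (by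
    rw [TopologicalSpace.Opens.openPartialHomeomorphSubtypeCoe_target]
    exact hγ)

/-- With a single chart, an inclusion, the only transition map is the identity of the open set; the
Hausdorff property comes from separation of the seminorms. -/
theorem isTameManifold_immersions (I : Domain) (h : (curveGraded I Plane).IsTame) :
    IsTameManifold (immersions I) (immersionAtlas I) := by
  have : T2Space (curveGraded I Plane) := h.1.t2Space
  refine ⟨inferInstanceAs (T2Space {x // x ∈ immersions I}), ?_, fun x => ⟨_, rfl, trivial⟩, ?_⟩
  · rintro c rfl
    exact h
  · rintro c rfl c' rfl
    have : IsSmoothTameOn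
        ((immersions I).openPartialHomeomorphSubtypeCoe (nonempty_immersions I) ∘
          ((immersions I).openPartialHomeomorphSubtypeCoe (nonempty_immersions I)).symm)
        (((immersions I).openPartialHomeomorphSubtypeCoe (nonempty_immersions I)).symm.trans
          ((immersions I).openPartialHomeomorphSubtypeCoe (nonempty_immersions I))).source := by
      refine (isSmoothTameOn_id _ _).congr fun γ hγ => immersionChart_symm_apply I ?_
      have := hγ.1
      simpa using this
    exact ⟨this, this⟩

/-- The set is a level set of a continuous function, hence closed, and the chart for homogeneous
functions applies with the curve itself as base point. Its hyperplane model is a tame summand of the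
ambient space. -/
theorem isTameSubmanifold_lengthOne (I : Domain) (h : (curveGraded I Plane).IsTame) :
    IsTameSubmanifold (immersionAtlas I) (lengthOne I) := by
  set j := (immersions I).openPartialHomeomorphSubtypeCoe (nonempty_immersions I)
  have hlen : lengthOne I = {γ | normIntegral (velocity I γ.1) = 1} := rfl
  refine ⟨?_, fun γ hγ => ?_⟩
  · rw [hlen]
    refine isClosed_eq (continuous_iff_continuousAt.2 fun γ => ?_) continuous_const
    refine ContinuousAt.comp (g := normIntegral) ?_
      ((continuous_velocity I).comp continuous_subtype_val).continuousAt
    exact contDiffOn_normIntegral.continuousOn.continuousAt (isOpen_nonvanishing.mem_nhds γ.2)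
  · set v : Plane := velocity I γ.1 0
    have hv : v ≠ 0 := γ.2 0
    -- The component of the initial velocity along that of `γ`, normalised to be `1` at `γ`; this is
    -- possible since `γ` is an immersion.
    let m : C(unitInterval, Plane) →L[ℝ] ℝ :=
      (‖v‖ ^ 2)⁻¹ • (innerSL ℝ v).comp (ContinuousMap.evalCLM ℝ 0)
    have hm : m (velocity I γ.1) = 1 := by
      change (‖v‖ ^ 2)⁻¹ * inner ℝ v v = 1
      rw [real_inner_self_eq_norm_sq, inv_mul_cancel₀]
      exact pow_ne_zero 2 (norm_ne_zero_iff.2 hv)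
    obtain ⟨ψ, hsrc, hψ, hψ', hsnd⟩ := exists_chart_of_homogeneous (velocity I)
      (norm_velocity_le I) isOpen_nonvanishing
      (fun y hy t ht s => smul_ne_zero ht.ne' (hy s)) contDiffOn_normIntegral
      (fun y => normIntegral_pos) normIntegral_smul m γ.1 hm
    have hmem : ∀ x ∈ ψ.source, x ∈ immersions I := fun x hx => by
      rw [hsrc] at hx
      exact hx.1
    refine ⟨_, realGraded, j.trans ψ, ?_, realGraded_isTame, ?_, ?_, ?_⟩
    · refine (isTameSummand_kernel (v := γ.1) hm (m := 1) (C := ‖m‖) fun x => ?_).isTame_of_isTame h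
      refine (m.le_opNorm _).trans (mul_le_mul_of_nonneg_left ?_ (norm_nonneg m))
      simpa using norm_velocity_le I x
    · rintro c rfl
      -- As `j` is an inclusion, the transition maps are restrictions of `ψ.symm` and `ψ`.
      constructor
      · refine (hψ'.mono (U' := ((j.trans ψ).symm.trans j).source) fun z hz => ?_).congr
          fun z hz => ?_
        · exact hz.1.1
        · exact immersionChart_symm_apply I (hmem _ (ψ.map_target hz.1.1))
      · have hs : (j.symm.trans (j.trans ψ)).source ⊆ ψ.source := fun x hx => by
          have h1 : x ∈ immersions I := by simpa [j] using hx.1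
          have h2 : (j.symm x).1 ∈ ψ.source := hx.2.2
          rwa [immersionChart_symm_apply I h1] at h2
        refine (hψ.mono hs).congr fun x hx => ?_
        change ψ (j.symm x).1 = ψ x
        rw [immersionChart_symm_apply I (hmem x (hs hx))]
    · refine ⟨trivial, ?_⟩
      change γ.1 ∈ ψ.source
      rw [hsrc]
      exact ⟨γ.2, by rw [hm]; exact one_pos⟩
    · intro y _
      change normIntegral (velocity I y.1) = 1 ↔ Prod.snd (ψ y.1) = (0 : ℝ)
      exact ⟨fun h => (hsnd y.1).trans (sub_eq_zero.2 h), fun h =>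
        sub_eq_zero.1 ((hsnd y.1).symm.trans h)⟩

/-! ### Towers of derivatives -/

section Tower

variable {V : Type} [NormedAddCommGroup V] [NormedSpace ℝ V] {s : Set ℝ} {f : ℝ → V}
  {F : ℕ → ℝ → V}

/-- A guessed formula for all derivatives need only be checked one differentiation at a time. Affine
pullbacks, Fourier series and reflections are all treated this way. -/
theorem iteratedDerivWithin_eqOn_of_tower (hs : UniqueDiffOn ℝ s) (h0 : EqOn f (F 0) s)
    (h : ∀ n, ∀ x ∈ s, HasDerivWithinAt (F n) (F (n + 1) x) s x) (n : ℕ) :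
    EqOn (iteratedDerivWithin n f s) (F n) s := by
  induction n with
  | zero => simpa [iteratedDerivWithin_zero] using h0
  | succ n ih =>
    intro x hx
    rw [iteratedDerivWithin_succ, derivWithin_congr ih (ih hx)]
    exact (h n x hx).derivWithin (hs x hx)

theorem contDiffOn_of_tower (hs : UniqueDiffOn ℝ s) (h0 : EqOn f (F 0) s)
    (h : ∀ n, ∀ x ∈ s, HasDerivWithinAt (F n) (F (n + 1) x) s x) : ContDiffOn ℝ ∞ f s :=
  contDiffOn_of_differentiableOn_deriv fun m _ x hx =>
    ((h m x hx).differentiableWithinAt.congr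
      (fun _ hy => iteratedDerivWithin_eqOn_of_tower hs h0 h m hy)
      (iteratedDerivWithin_eqOn_of_tower hs h0 h m hx))

theorem hasDerivWithinAt_iteratedDerivWithin (hs : UniqueDiffOn ℝ s) (hf : ContDiffOn ℝ ∞ f s)
    (n : ℕ) {x : ℝ} (hx : x ∈ s) : HasDerivWithinAt (iteratedDerivWithin n f s)
      (iteratedDerivWithin (n + 1) f s x) s x := by
  rw [iteratedDerivWithin_succ]
  exact (hf.differentiableOn_iteratedDerivWithin (m := n)
    (by exact_mod_cast WithTop.coe_lt_top _) hs x hx).hasDerivWithinAt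

end Tower

/-! ### Affine pullbacks, linear postcomposition and tame maps between curve spaces -/

section SmoothMap

variable {I I' : Domain} {V W : Type} [NormedAddCommGroup V] [NormedSpace ℝ V]
  [NormedAddCommGroup W] [NormedSpace ℝ W]

namespace SmoothMap

/-- The `j`-th derivative of a smooth map, as a function of a real parameter. -/
def jet (f : SmoothMap I V) (j : ℕ) : ℝ → V := iteratedDerivWithin j (f.1 ∘ I.proj) I.param

theorem iterDeriv_apply (f : SmoothMap I V) (j : ℕ) (s : unitInterval) :
    iterDeriv I V j f s = f.jet j s := rfl

theorem jet_zero (f : SmoothMap I V) : f.jet 0 = f.1 ∘ I.proj := iteratedDerivWithin_zero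

theorem hasDerivWithinAt_jet (f : SmoothMap I V) (j : ℕ) {x : ℝ} (hx : x ∈ I.param) :
    HasDerivWithinAt (f.jet j) (f.jet (j + 1) x) I.param x :=
  hasDerivWithinAt_iteratedDerivWithin I.uniqueDiffOn_param f.2 j hx

theorem continuousOn_jet (f : SmoothMap I V) (j : ℕ) : ContinuousOn (f.jet j) I.param :=
  fun _ hx => (f.hasDerivWithinAt_jet j hx).continuousWithinAt

theorem jet_eqOn_of_tower (f : SmoothMap I V) {F : ℕ → ℝ → V}
    (h0 : EqOn (f.1 ∘ I.proj) (F 0) I.param)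
    (h : ∀ n, ∀ x ∈ I.param, HasDerivWithinAt (F n) (F (n + 1) x) I.param x) (n : ℕ) :
    EqOn (f.jet n) (F n) I.param :=
  iteratedDerivWithin_eqOn_of_tower I.uniqueDiffOn_param h0 h n

/-- Every derivative at a parameter is attained at a parameter in the unit interval. -/
theorem exists_jet_eq (f : SmoothMap I V) {x : ℝ} (hx : x ∈ I.param) :
    ∃ s : unitInterval, ∀ j, f.jet j x = iterDeriv I V j f s := by
  cases I with
  | interval => exact ⟨⟨x, hx⟩, fun j => rfl⟩
  | circle =>
    refine ⟨⟨Int.fract x, Int.fract_nonneg x, (Int.fract_lt_one x).le⟩, fun j => ?_⟩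
    change iteratedDerivWithin j (f.1 ∘ Domain.circle.proj) univ x =
      iteratedDerivWithin j (f.1 ∘ Domain.circle.proj) univ (Int.fract x)
    rw [iteratedDerivWithin_univ]
    have hp : (fun t => (f.1 ∘ Domain.circle.proj) (t - ⌊x⌋)) = f.1 ∘ Domain.circle.proj := by
      funext t
      refine congrArg f.1 ?_
      change ((t - ⌊x⌋ : ℝ) : UnitAddCircle) = t
      have h : ((⌊x⌋ : ℝ) : UnitAddCircle) = 0 := (AddCircle.coe_eq_zero_iff 1).2 ⟨⌊x⌋, by simp⟩
      rw [AddCircle.coe_sub, h, sub_zero]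
    have h := congrFun (iteratedDeriv_comp_sub_const j (f.1 ∘ Domain.circle.proj) (⌊x⌋ : ℝ)) x
    rw [hp] at h
    exact h

/-- Pullback of smooth maps under a map which is affine in the parameters. -/
def pullback (c d : ℝ) (ρ : I'.Pt → I.Pt) (hmap : ∀ t ∈ I'.param, c * t + d ∈ I.param)
    (hρ : ∀ t ∈ I'.param, ρ (I'.proj t) = I.proj (c * t + d)) :
    SmoothMap I V →ₗ[ℝ] SmoothMap I' V where
  toFun f := ⟨f.1 ∘ ρ, by
    have h : ContDiff ℝ ∞ fun t : ℝ => c * t + d :=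
      (contDiff_const.mul contDiff_id).add contDiff_const
    exact (ContDiffOn.comp (g := f.1 ∘ I.proj) f.2 h.contDiffOn hmap).congr
      fun t ht => congrArg f.1 (hρ t ht)⟩
  map_add' _ _ := rfl
  map_smul' _ _ := rfl

theorem pullback_jet (c d : ℝ) (ρ : I'.Pt → I.Pt) (hmap : ∀ t ∈ I'.param, c * t + d ∈ I.param)
    (hρ : ∀ t ∈ I'.param, ρ (I'.proj t) = I.proj (c * t + d)) (f : SmoothMap I V) (n : ℕ) {t : ℝ}
    (ht : t ∈ I'.param) : (pullback c d ρ hmap hρ f).jet n t = c ^ n • f.jet n (c * t + d) := by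
  refine jet_eqOn_of_tower _ (F := fun n t => c ^ n • f.jet n (c * t + d)) (fun t ht => ?_)
    (fun n x hx => ?_) n ht
  · have h : c ^ 0 • f.jet 0 (c * t + d) = f.jet 0 (c * t + d) := by rw [pow_zero, one_smul]
    exact (congrArg f.1 (hρ t ht)).trans ((congrFun f.jet_zero _).symm.trans h.symm)
  · have h1 : HasDerivWithinAt (fun t : ℝ => c * t + d) c I'.param x := by
      simpa using (((hasDerivAt_id x).const_mul c).add_const d).hasDerivWithinAt
    have h2 := ((f.hasDerivWithinAt_jet n (hmap x hx)).scomp x h1 hmap).const_smul (c ^ n)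
    refine h2.congr_deriv ?_
    rw [smul_smul, pow_succ]

theorem norm_iterDeriv_pullback_le (c d : ℝ) (ρ : I'.Pt → I.Pt)
    (hmap : ∀ t ∈ I'.param, c * t + d ∈ I.param)
    (hρ : ∀ t ∈ I'.param, ρ (I'.proj t) = I.proj (c * t + d)) (f : SmoothMap I V) (n : ℕ) {A : ℝ}
    (hA : ∀ s, ‖iterDeriv I V n f s‖ ≤ A) (s : unitInterval) :
    ‖iterDeriv I' V n (pullback c d ρ hmap hρ f) s‖ ≤ |c| ^ n * A := by
  obtain ⟨s', hs'⟩ := f.exists_jet_eq (hmap s (I'.mem_param s))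
  rw [iterDeriv_apply, pullback_jet _ _ _ _ _ _ _ (I'.mem_param s), norm_smul, norm_pow,
    Real.norm_eq_abs, hs']
  exact mul_le_mul_of_nonneg_left (hA s') (by positivity)

/-- Composition of smooth maps with a continuous linear map of the target. -/
def postcomp (I : Domain) (A : V →L[ℝ] W) : SmoothMap I V →ₗ[ℝ] SmoothMap I W where
  toFun f := ⟨A ∘ f.1, A.contDiff.comp_contDiffOn f.2⟩
  map_add' f g := Subtype.ext (funext fun p => A.map_add (f.1 p) (g.1 p))
  map_smul' c f := Subtype.ext (funext fun p => A.map_smul c (f.1 p))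

theorem iterDeriv_postcomp (A : V →L[ℝ] W) (f : SmoothMap I V) (n : ℕ) (s : unitInterval) :
    iterDeriv I W n (postcomp I A f) s = A (iterDeriv I V n f s) := by
  refine jet_eqOn_of_tower (postcomp I A f) (F := fun n t => A (f.jet n t)) (fun t ht => ?_)
    (fun n x hx => ?_) n (I.mem_param s)
  · change A (f.1 (I.proj t)) = _
    rw [jet_zero]
    rfl
  · exact A.hasFDerivAt.comp_hasDerivWithinAt x (f.hasDerivWithinAt_jet n hx)

end SmoothMap

theorem norm_iterDeriv_succ_le {j k : ℕ} (h : j < k) (f : SmoothMap I V) (s : unitInterval) :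
    ‖iterDeriv I V (j + 1) f s‖ ≤ (curveGraded I V).seminorm k (toCurveMod I V f) :=
  norm_derivMod_le h (toCurveMod I V f) s

/-- A linear map into `C^∞(I, V) / V` is tame if each derivative satisfies a tame estimate. -/
theorem isTameLinear_of_iterDeriv {E : GradedSpace} (L : E →ₗ[ℝ] curveGraded I V)
    {r : ℕ} (h : ∀ n, ∃ C : ℝ, ∀ x, ∃ f : SmoothMap I V, L x = toCurveMod I V f ∧
      ∀ s, ‖iterDeriv I V (n + 1) f s‖ ≤ C * E.seminorm (n + 1 + r) x) : IsTameLinear L := by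
  choose C hC using h
  -- The `n`-th seminorm sums the derivatives of order `j + 1 ≤ n`, so every degree `j + 1 + r` that
  -- occurs is at most `n + r`.
  refine ⟨r, 0, fun n => ∑ j ∈ Finset.range n, |C j|, fun n _ x => ?_⟩
  rw [Finset.sum_mul]
  change ∑ j ∈ Finset.range n, ⨆ s, ‖derivMod I V j (L x) s‖ ≤ _
  refine Finset.sum_le_sum fun j hj => ciSup_le fun s => ?_
  obtain ⟨f, hf, hb⟩ := hC j x
  rw [hf]
  refine (hb s).trans (mul_le_mul (le_abs_self _) (E.seminorm_le ?_ x) (apply_nonneg _ _)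
    (abs_nonneg _))
  have := Finset.mem_range.1 hj
  omega

/-- The linear map of curves modulo translations induced by a linear map which preserves the
constant maps. -/
def curveMap (A : SmoothMap I V →ₗ[ℝ] SmoothMap I' W)
    (hA : constMaps I V ≤ (constMaps I' W).comap A) : curveGraded I V →ₗ[ℝ] curveGraded I' W :=
  (constMaps I V).mapQ (constMaps I' W) A hA

theorem curveMap_toCurveMod (A : SmoothMap I V →ₗ[ℝ] SmoothMap I' W)
    (hA : constMaps I V ≤ (constMaps I' W).comap A) (f : SmoothMap I V) :
    curveMap A hA (toCurveMod I V f) = toCurveMod I' W (A f) := rfl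

theorem toCurveMod_surjective (γ : curveGraded I V) : ∃ f, toCurveMod I V f = γ :=
  Submodule.mkQ_surjective (constMaps I V) γ

theorem isTameLinear_curveMap (A : SmoothMap I V →ₗ[ℝ] SmoothMap I' W)
    (hA : constMaps I V ≤ (constMaps I' W).comap A) {r : ℕ}
    (h : ∀ n, ∃ C : ℝ, ∀ f s, ‖iterDeriv I' W (n + 1) (A f) s‖ ≤
      C * (curveGraded I V).seminorm (n + 1 + r) (toCurveMod I V f)) :
    IsTameLinear (curveMap A hA) := by
  refine isTameLinear_of_iterDeriv (r := r) _ fun n => ?_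
  obtain ⟨C, hC⟩ := h n
  refine ⟨C, fun γ => ?_⟩
  obtain ⟨f, rfl⟩ := toCurveMod_surjective γ
  exact ⟨A f, rfl, hC f⟩

theorem isTameSummand_of_continuousLinearEquiv (I : Domain) (A : V ≃L[ℝ] W) :
    (curveGraded I V).IsTameSummand (curveGraded I W) := by
  have hc : ∀ {V W : Type} [NormedAddCommGroup V] [NormedSpace ℝ V] [NormedAddCommGroup W]
      [NormedSpace ℝ W] (B : V →L[ℝ] W),
      constMaps I V ≤ (constMaps I W).comap (SmoothMap.postcomp I B) := by
    rintro V W _ _ _ _ B f ⟨v, hv⟩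
    exact ⟨B v, fun p => congrArg B (hv p)⟩
  have ht : ∀ {V W : Type} [NormedAddCommGroup V] [NormedSpace ℝ V] [NormedAddCommGroup W]
      [NormedSpace ℝ W] (B : V →L[ℝ] W),
      IsTameLinear (curveMap (SmoothMap.postcomp I B) (hc B)) := by
    intro V W _ _ _ _ B
    refine isTameLinear_curveMap (r := 0) _ _ fun n => ⟨‖B‖, fun f s => ?_⟩
    rw [SmoothMap.iterDeriv_postcomp]
    exact (B.le_opNorm _).trans (mul_le_mul_of_nonneg_left
      (norm_iterDeriv_succ_le (Nat.lt_succ_self n) f s) (norm_nonneg B))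
  refine ⟨_, _, ht (A : V →L[ℝ] W), ht (A.symm : W →L[ℝ] V), fun γ => ?_⟩
  obtain ⟨f, rfl⟩ := toCurveMod_surjective γ
  rw [curveMap_toCurveMod, curveMap_toCurveMod]
  exact congrArg _ (Subtype.ext (funext fun p => A.symm_apply_apply (f.1 p)))

end SmoothMap

/-! ### Fourier series: smooth periodic curves form a tame space -/

section Fourier

open Complex in
/-- The factor by which differentiation multiplies the `m`-th Fourier mode. -/
def freq (m : ℤ) : ℂ := 2 * Real.pi * I * m

theorem norm_freq (m : ℤ) : ‖freq m‖ = 2 * Real.pi * |(m : ℝ)| := by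
  simp [freq, Real.pi_pos.le]

theorem norm_fourier_apply (m : ℤ) (x : UnitAddCircle) : ‖fourier m x‖ = 1 :=
  Circle.norm_coe _

theorem hasDerivAt_fourier_one (m : ℤ) (x : ℝ) :
    HasDerivAt (fun y : ℝ => fourier m (y : UnitAddCircle)) (freq m * fourier m (x : UnitAddCircle))
      x := by
  have h := hasDerivAt_fourier 1 m x
  rwa [Complex.ofReal_one, div_one] at h

theorem continuous_fourier_coe (m : ℤ) : Continuous fun x : ℝ => fourier m (x : UnitAddCircle) :=
  (map_continuous (fourier m)).comp (AddCircle.continuous_mk' 1)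

variable (f : SmoothMap Domain.circle ℂ)

theorem continuous_jet_circle {V : Type} [NormedAddCommGroup V] [NormedSpace ℝ V]
    (f : SmoothMap Domain.circle V) (j : ℕ) : Continuous (f.jet j) :=
  continuousOn_univ.1 (f.continuousOn_jet j)

/-- The `m`-th Fourier coefficient of the `j`-th derivative. -/
def jetCoeff (j : ℕ) (m : ℤ) : ℂ := ∫ x in (0 : ℝ)..1, fourier (-m) (x : UnitAddCircle) * f.jet j x

theorem jetCoeff_zero (m : ℤ) : jetCoeff f 0 m = fourierCoeff (T := 1) f.1 m := by
  let F : UnitAddCircle → ℂ := f.1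
  have h := fourierCoeff_eq_intervalIntegral (T := 1) F m 0
  simp only [zero_add, div_one, one_smul, smul_eq_mul] at h
  rw [jetCoeff, SmoothMap.jet_zero]
  exact h.symm

theorem norm_jetCoeff_le {j : ℕ} (m : ℤ) {A : ℝ}
    (hA : ∀ s, ‖iterDeriv Domain.circle ℂ j f s‖ ≤ A) : ‖jetCoeff f j m‖ ≤ A := by
  have h := intervalIntegral.norm_integral_le_of_norm_le_const (a := (0 : ℝ)) (b := 1) (C := A)
    (f := fun x : ℝ => fourier (-m) (x : UnitAddCircle) * f.jet j x) fun x hx => by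
      rw [uIoc_of_le zero_le_one] at hx
      rw [norm_mul, norm_fourier_apply, one_mul]
      exact hA ⟨x, hx.1.le, hx.2⟩
  rwa [sub_zero, abs_one, mul_one] at h

/-- Integration by parts over a period: the boundary terms cancel by periodicity, and the minus sign
is absorbed by `freq (-m) = -freq m`. -/
theorem jetCoeff_succ (j : ℕ) (m : ℤ) : jetCoeff f (j + 1) m = freq m * jetCoeff f j m := by
  have hv : ∀ x ∈ uIcc (0 : ℝ) 1, HasDerivAt (f.jet j) (f.jet (j + 1) x) x := fun x _ => by
    exact (f.hasDerivWithinAt_jet j (x := x) (mem_univ x)).hasDerivAt univ_mem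
  have h := intervalIntegral.integral_mul_deriv_eq_deriv_mul
    (fun x _ => hasDerivAt_fourier_one (-m) x) hv
    ((continuous_const.mul (continuous_fourier_coe (-m))).intervalIntegrable 0 1)
    ((continuous_jet_circle f (j + 1)).intervalIntegrable 0 1)
  have hper : f.jet j 1 = f.jet j 0 := by
    change iteratedDerivWithin j (f.1 ∘ Domain.circle.proj) univ 1 =
      iteratedDerivWithin j (f.1 ∘ Domain.circle.proj) univ 0
    rw [iteratedDerivWithin_univ]
    have hp : (fun t => (f.1 ∘ Domain.circle.proj) (t + 1)) = f.1 ∘ Domain.circle.proj :=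
      funext fun t => congrArg f.1 (AddCircle.coe_add_period 1 t)
    have h := congrFun (iteratedDeriv_comp_add_const j (f.1 ∘ Domain.circle.proj) 1) 0
    rw [hp, zero_add] at h
    exact h.symm
  have h1 : ((1 : ℝ) : UnitAddCircle) = ((0 : ℝ) : UnitAddCircle) := by
    rw [← AddCircle.coe_add_period (1 : ℝ) 0, zero_add]
  have h2 : freq (-m) = - freq m := by simp [freq]
  rw [h1, hper, sub_self, zero_sub, h2] at h
  rw [jetCoeff, h, jetCoeff, ← intervalIntegral.integral_const_mul, ← intervalIntegral.integral_neg]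
  exact intervalIntegral.integral_congr fun x _ => by ring

theorem jetCoeff_eq (j : ℕ) (m : ℤ) : jetCoeff f j m = freq m ^ j * jetCoeff f 0 m := by
  induction j with
  | zero => simp
  | succ j ih => rw [jetCoeff_succ, ih, pow_succ]; ring

/-- The coefficient of the `j`-th derivative carries the factor `freq m ^ j`, and `2π ≥ 1` may be
dropped from its norm. -/
theorem abs_pow_mul_norm_jetCoeff_le {j : ℕ} (m : ℤ) {A : ℝ}
    (hA : ∀ s, ‖iterDeriv Domain.circle ℂ j f s‖ ≤ A) :
    |(m : ℝ)| ^ j * ‖jetCoeff f 0 m‖ ≤ A := by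
  refine le_trans ?_ (norm_jetCoeff_le f m hA)
  rw [jetCoeff_eq f j m, norm_mul, norm_pow, norm_freq, mul_pow]
  have : 1 ≤ (2 * Real.pi) ^ j := one_le_pow₀ (by linarith [Real.two_le_pi])
  have h2 : 0 ≤ |(m : ℝ)| ^ j * ‖jetCoeff f 0 m‖ := by positivity
  nlinarith

/-- The `m`-th Fourier coefficient, as a linear functional. -/
def coeffLinear (m : ℤ) : SmoothMap Domain.circle ℂ →ₗ[ℝ] ℂ where
  toFun f := jetCoeff f 0 m
  map_add' f g := by
    have hi : ∀ f : SmoothMap Domain.circle ℂ, IntervalIntegrable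
        (fun x : ℝ => fourier (-m) (x : UnitAddCircle) * f.jet 0 x) volume 0 1 := fun f =>
      ((continuous_fourier_coe (-m)).mul (continuous_jet_circle f 0)).intervalIntegrable 0 1
    rw [jetCoeff, jetCoeff, jetCoeff, ← intervalIntegral.integral_add (hi f) (hi g)]
    refine intervalIntegral.integral_congr fun x _ => ?_
    simp only [SmoothMap.jet_zero]
    exact mul_add _ (f.1 (Domain.circle.proj x)) (g.1 (Domain.circle.proj x))
  map_smul' c f := by
    rw [jetCoeff, jetCoeff, RingHom.id_apply, ← intervalIntegral.integral_smul]
    refine intervalIntegral.integral_congr fun x _ => ?_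
    simp only [SmoothMap.jet_zero]
    exact mul_smul_comm c _ (f.1 (Domain.circle.proj x))

/-- The index of the exponential block of frequencies containing `m`. -/
def block (m : ℤ) : ℕ := ⌊Real.log |(m : ℝ)|⌋₊

theorem one_le_abs_intCast {m : ℤ} (hm : m ≠ 0) : 1 ≤ |(m : ℝ)| := by
  exact_mod_cast Int.one_le_abs hm

theorem exp_block_le {m : ℤ} (hm : m ≠ 0) : Real.exp (block m) ≤ |(m : ℝ)| := by
  have h1 := one_le_abs_intCast hm
  rw [← Real.le_log_iff_exp_le (by linarith)]
  exact Nat.floor_le (Real.log_nonneg h1)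

theorem abs_le_exp_block {m : ℤ} (hm : m ≠ 0) : |(m : ℝ)| ≤ Real.exp (block m + 1) := by
  have h1 := one_le_abs_intCast hm
  rw [← Real.log_le_iff_le_exp (by linarith)]
  exact (Nat.lt_floor_add_one _).le

theorem exists_bound_iterDeriv {I : Domain} {V : Type} [NormedAddCommGroup V] [NormedSpace ℝ V]
    (f : SmoothMap I V) (j : ℕ) : ∃ A, ∀ s, ‖iterDeriv I V j f s‖ ≤ A := by
  have hc : Continuous (iterDeriv I V j f) :=
    (f.continuousOn_jet j).comp_continuous continuous_subtype_val I.mem_param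
  obtain ⟨A, hA⟩ := (isCompact_range hc.norm).bddAbove
  exact ⟨A, fun s => hA ⟨s, rfl⟩⟩

/-- The Fourier coefficients of nonzero frequencies in the block `k`. -/
def blockCoeff (k : ℕ) : SmoothMap Domain.circle ℂ →ₗ[ℝ] BoundedContinuousFunction ℤ ℂ where
  toFun f := BoundedContinuousFunction.ofNormedAddCommGroupDiscrete
    -- Since `Real.log 0 = 0`, frequency `0` would fall into block `0`; it is excluded because the
    -- mean is invisible modulo translations.
    (fun m => if block m = k ∧ m ≠ 0 then coeffLinear m f else 0)
    (max 0 (exists_bound_iterDeriv f 0).choose) fun m => by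
      split_ifs
      · exact (norm_jetCoeff_le f m (exists_bound_iterDeriv f 0).choose_spec).trans
          (le_max_right _ _)
      · simp
  map_add' f g := by
    ext m
    simp only [BoundedContinuousFunction.coe_ofNormedAddCommGroupDiscrete,
      BoundedContinuousFunction.coe_add, Pi.add_apply, map_add]
    split_ifs <;> simp
  map_smul' c f := by
    ext m
    simp only [BoundedContinuousFunction.coe_ofNormedAddCommGroupDiscrete,
      BoundedContinuousFunction.coe_smul, map_smul, RingHom.id_apply]
    split_ifs <;> simp

theorem blockCoeff_apply (k : ℕ) (m : ℤ) :
    blockCoeff k f m = if block m = k ∧ m ≠ 0 then jetCoeff f 0 m else 0 := rfl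

/-- On block `k` the `(n + 1)`-st derivative bounds `e ^ ((n + 1) k)` times each coefficient. One
factor `e ^ k` is given up so that the estimate is summable over `k`; this is the derivative lost by
the analysis map. -/
theorem exp_mul_norm_blockCoeff_le (n k : ℕ) :
    Real.exp (n * k) * ‖blockCoeff k f‖ ≤ Real.exp (-k) *
      (curveGraded Domain.circle ℂ).seminorm (n + 1) (toCurveMod Domain.circle ℂ f) := by
  set A := (curveGraded Domain.circle ℂ).seminorm (n + 1) (toCurveMod Domain.circle ℂ f)
  have hA0 : 0 ≤ A := apply_nonneg _ _
  rw [← le_div_iff₀' (Real.exp_pos _), BoundedContinuousFunction.norm_le (by positivity)]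
  intro m
  rw [blockCoeff_apply, le_div_iff₀' (Real.exp_pos _)]
  split_ifs with h
  · obtain ⟨rfl, hm⟩ := h
    have h1 := abs_pow_mul_norm_jetCoeff_le f m
      (fun s => norm_iterDeriv_succ_le (Nat.lt_succ_self n) f s)
    have h2 : Real.exp (block m) ^ (n + 1) ≤ |(m : ℝ)| ^ (n + 1) :=
      pow_le_pow_left₀ (Real.exp_pos _).le (exp_block_le hm) _
    have h3 : Real.exp (n * block m) = Real.exp (-(block m)) * Real.exp (block m) ^ (n + 1) := by
      rw [← Real.exp_nat_mul, ← Real.exp_add]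
      congr 1
      push_cast
      ring
    rw [h3, mul_assoc]
    exact mul_le_mul_of_nonneg_left
      ((mul_le_mul_of_nonneg_right h2 (norm_nonneg _)).trans h1) (Real.exp_pos _).le
  · rw [norm_zero, mul_zero]
    positivity

theorem summable_exp_neg : Summable fun k : ℕ => Real.exp (-k) := by
  have := Real.summable_exp_nat_mul_iff.2 (show (-1 : ℝ) < 0 by norm_num)
  simpa using this

theorem blockCoeff_mem :
    (fun k => blockCoeff k f) ∈ expDecSubmodule (BoundedContinuousFunction ℤ ℂ) :=
  fun n => Summable.of_nonneg_of_le (fun k => by positivity)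
    (fun k => exp_mul_norm_blockCoeff_le f n k) (summable_exp_neg.mul_right _)

/-- The Fourier coefficients of a periodic curve modulo translations. -/
def fourierAnalysis :
    curveGraded Domain.circle ℂ →ₗ[ℝ] expDec (BoundedContinuousFunction ℤ ℂ) :=
  (constMaps Domain.circle ℂ).liftQ
    ((LinearMap.pi blockCoeff).codRestrict (expDecSubmodule (BoundedContinuousFunction ℤ ℂ))
      blockCoeff_mem) fun f hf => by
    have h0 : toCurveMod Domain.circle ℂ f = 0 := (Submodule.Quotient.mk_eq_zero _).2 hf
    refine LinearMap.mem_ker.2 (Subtype.ext (funext fun k => ?_))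
    -- Constants have zero seminorm, so the estimate itself shows that their blocks vanish.
    have h1 := exp_mul_norm_blockCoeff_le f 0 k
    have h2 : (curveGraded Domain.circle ℂ).seminorm (0 + 1) (toCurveMod Domain.circle ℂ f) = 0 :=
      (congrArg ((curveGraded Domain.circle ℂ).seminorm (0 + 1)) h0).trans (map_zero _)
    rw [h2, mul_zero] at h1
    exact norm_le_zero_iff.1 (nonpos_of_mul_nonpos_right h1 (Real.exp_pos _))

theorem fourierAnalysis_toCurveMod (k : ℕ) :
    (fourierAnalysis (toCurveMod Domain.circle ℂ f)).1 k = blockCoeff k f := rfl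

theorem isTameLinear_fourierAnalysis : IsTameLinear fourierAnalysis := by
  refine ⟨1, 0, fun _ => ∑' k : ℕ, Real.exp (-k), fun n _ γ => ?_⟩
  obtain ⟨f, rfl⟩ := toCurveMod_surjective γ
  rw [← tsum_mul_right]
  exact ((blockCoeff_mem f) n).tsum_le_tsum (fun k => exp_mul_norm_blockCoeff_le f n k)
    (summable_exp_neg.mul_right _)

/-! ### Fourier synthesis from rapidly decreasing coefficients -/

section Synthesis

/-- Sequences of Fourier coefficients of smooth functions of mean zero. -/
def IsRapid (d : ℤ → ℂ) : Prop := d 0 = 0 ∧ ∀ n : ℕ, ∃ A, ∀ m : ℤ, |(m : ℝ)| ^ n * ‖d m‖ ≤ A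

/-- The `j`-th derivative of the Fourier series with coefficients `d`. -/
def fourierSeries (d : ℤ → ℂ) (j : ℕ) (t : ℝ) : ℂ :=
  ∑' m : ℤ, freq m ^ j * d m * fourier m (t : UnitAddCircle)

/-- Two powers of `|m|` beyond the `j` used by differentiation supply the summable factor `1 / m²`.
At `m = 0` the bound reads `0` by the convention for division, which is why `d 0 = 0` is required.
-/
theorem norm_fourierSeries_term_le {d : ℤ → ℂ} (h0 : d 0 = 0) {j : ℕ} {A : ℝ}
    (hA : ∀ m : ℤ, |(m : ℝ)| ^ (j + 2) * ‖d m‖ ≤ A) (t : ℝ) (m : ℤ) :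
    ‖freq m ^ j * d m * fourier m (t : UnitAddCircle)‖ ≤
      (2 * Real.pi) ^ j * A * (1 / (m : ℝ) ^ 2) := by
  rw [norm_mul, norm_mul, norm_pow, norm_freq, norm_fourier_apply, mul_one, mul_pow]
  rcases eq_or_ne m 0 with rfl | hm
  · simp [h0]
  · have h1 := one_le_abs_intCast hm
    have h2 : (0 : ℝ) < |(m : ℝ)| ^ 2 := by positivity
    have h3 : |(m : ℝ)| ^ j * ‖d m‖ ≤ A * (1 / (m : ℝ) ^ 2) := by
      rw [mul_one_div, ← sq_abs, le_div_iff₀ h2]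
      refine le_trans (le_of_eq ?_) (hA m)
      ring
    rw [mul_assoc, mul_assoc]
    exact mul_le_mul_of_nonneg_left h3 (by positivity)

theorem summable_one_div_sq : Summable fun m : ℤ => 1 / (m : ℝ) ^ 2 :=
  Real.summable_one_div_int_pow.2 one_lt_two

theorem IsRapid.summable {d : ℤ → ℂ} (hd : IsRapid d) (j : ℕ) (t : ℝ) :
    Summable fun m : ℤ => freq m ^ j * d m * fourier m (t : UnitAddCircle) := by
  obtain ⟨A, hA⟩ := hd.2 (j + 2)
  exact Summable.of_norm_bounded (summable_one_div_sq.mul_left _)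
    (norm_fourierSeries_term_le hd.1 hA t)

theorem norm_fourierSeries_le {d : ℤ → ℂ} (h0 : d 0 = 0) {j : ℕ} {A : ℝ}
    (hA : ∀ m : ℤ, |(m : ℝ)| ^ (j + 2) * ‖d m‖ ≤ A) (t : ℝ) :
    ‖fourierSeries d j t‖ ≤ (2 * Real.pi) ^ j * A * ∑' m : ℤ, 1 / (m : ℝ) ^ 2 :=
  tsum_of_norm_bounded (summable_one_div_sq.hasSum.mul_left _)
    (norm_fourierSeries_term_le h0 hA t)

theorem IsRapid.hasDerivAt {d : ℤ → ℂ} (hd : IsRapid d) (j : ℕ) (t : ℝ) :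
    HasDerivAt (fourierSeries d j) (fourierSeries d (j + 1) t) t := by
  -- Termwise differentiation needs a summable bound for the terms of the derived series, of order
  -- `j + 1`.
  obtain ⟨A, hA⟩ := hd.2 (j + 1 + 2)
  refine hasDerivAt_tsum (summable_one_div_sq.mul_left ((2 * Real.pi) ^ (j + 1) * A))
    (g := fun m (t : ℝ) => freq m ^ j * d m * fourier m (t : UnitAddCircle))
    (g' := fun m (t : ℝ) => freq m ^ (j + 1) * d m * fourier m (t : UnitAddCircle)) (fun m t => ?_)
    (fun m t => norm_fourierSeries_term_le hd.1 hA t m) (hd.summable j 0) t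
  refine ((hasDerivAt_fourier_one m t).const_mul (freq m ^ j * d m)).congr_deriv ?_
  ring

/-- The smooth periodic function with given Fourier coefficients. -/
def fourierSynthesis (d : ℤ → ℂ) (hd : IsRapid d) : SmoothMap Domain.circle ℂ :=
  ⟨fun x => ∑' m : ℤ, d m * fourier m x, contDiffOn_of_tower (F := fourierSeries d)
    Domain.circle.uniqueDiffOn_param
    (fun t _ => tsum_congr fun m => by rw [pow_zero, one_mul]; rfl)
    fun n x _ => (hd.hasDerivAt n x).hasDerivWithinAt⟩

theorem iterDeriv_fourierSynthesis {d : ℤ → ℂ} (hd : IsRapid d) (n : ℕ) (s : unitInterval) :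
    iterDeriv Domain.circle ℂ n (fourierSynthesis d hd) s = fourierSeries d n s :=
  SmoothMap.jet_eqOn_of_tower (fourierSynthesis d hd) (F := fourierSeries d)
    (fun t _ => tsum_congr fun m => by rw [pow_zero, one_mul]; rfl)
    (fun n x _ => (hd.hasDerivAt n x).hasDerivWithinAt) n (Domain.circle.mem_param s)

/-- The coefficients of nonzero frequency encoded by a sequence of blocks. -/
def blockEntry (g : expDec (BoundedContinuousFunction ℤ ℂ)) (m : ℤ) : ℂ :=
  if m = 0 then 0 else g.1 (block m) m

/-- Within a block `|m|` exceeds `e ^ block m` by at most a factor `e`, so passing from block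
weights to powers of `|m|` costs only `e ^ n`. -/
theorem abs_pow_mul_norm_blockEntry_le (g : expDec (BoundedContinuousFunction ℤ ℂ)) (n : ℕ)
    (m : ℤ) : |(m : ℝ)| ^ n * ‖blockEntry g m‖ ≤
      Real.exp n * (expDec (BoundedContinuousFunction ℤ ℂ)).seminorm n g := by
  rw [blockEntry]
  split_ifs with hm
  · rw [norm_zero, mul_zero]
    exact mul_nonneg (Real.exp_pos _).le (apply_nonneg _ _)
  · have h1 : |(m : ℝ)| ^ n ≤ Real.exp n * Real.exp (n * block m) := by
      have e : Real.exp (block m + 1) ^ n = Real.exp n * Real.exp (n * block m) := by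
        rw [← Real.exp_nat_mul, ← Real.exp_add]
        congr 1
        ring
      rw [← e]
      exact pow_le_pow_left₀ (abs_nonneg _) (abs_le_exp_block hm) n
    have h2 := exp_mul_norm_le_seminorm n (block m) g
    have h3 := (g.1 (block m)).norm_coe_le_norm m
    calc |(m : ℝ)| ^ n * ‖g.1 (block m) m‖
        ≤ Real.exp n * Real.exp (n * block m) * ‖g.1 (block m)‖ :=
          mul_le_mul h1 h3 (norm_nonneg _) (by positivity)
      _ ≤ _ := by
          rw [mul_assoc]
          exact mul_le_mul_of_nonneg_left h2 (Real.exp_pos _).le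

theorem isRapid_blockEntry (g : expDec (BoundedContinuousFunction ℤ ℂ)) :
    IsRapid (blockEntry g) :=
  ⟨if_pos rfl, fun n => ⟨_, abs_pow_mul_norm_blockEntry_le g n⟩⟩

/-- The periodic smooth function with given blocks of Fourier coefficients. -/
def blockSynthesis : expDec (BoundedContinuousFunction ℤ ℂ) →ₗ[ℝ] SmoothMap Domain.circle ℂ where
  toFun g := fourierSynthesis (blockEntry g) (isRapid_blockEntry g)
  map_add' g h := by
    refine Subtype.ext (funext fun x => ?_)
    obtain ⟨t, rfl⟩ := QuotientAddGroup.mk_surjective x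
    have hs := fun g => (isRapid_blockEntry g).summable 0 t
    simp only [pow_zero, one_mul] at hs
    refine (tsum_congr fun m => ?_).trans ((hs g).tsum_add (hs h))
    have : blockEntry (g + h) m = blockEntry g m + blockEntry h m := by
      rw [blockEntry, blockEntry, blockEntry]
      split_ifs
      · rw [add_zero]
      · rfl
    rw [this, add_mul]
  map_smul' c g := by
    refine Subtype.ext (funext fun x => ?_)
    refine (tsum_congr fun m => ?_).trans (tsum_const_smul'' c)
    have : blockEntry (c • g) m = c • blockEntry g m := by
      rw [blockEntry, blockEntry]
      split_ifs
      · rw [smul_zero]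
      · rfl
    rw [this, smul_mul_assoc]

theorem isTameLinear_blockSynthesis :
    IsTameLinear (E := expDec (BoundedContinuousFunction ℤ ℂ)) (F := curveGraded Domain.circle ℂ)
      (toCurveMod Domain.circle ℂ ∘ₗ blockSynthesis) := by
  refine isTameLinear_of_iterDeriv (r := 2) _ fun n =>
    ⟨(2 * Real.pi) ^ (n + 1) * Real.exp (n + 1 + 2 : ℕ) * ∑' m : ℤ, 1 / (m : ℝ) ^ 2, fun g =>
      ⟨blockSynthesis g, rfl, fun s => ?_⟩⟩
  refine (congrArg norm (iterDeriv_fourierSynthesis (isRapid_blockEntry g) (n + 1) s)).trans_le ?_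
  have h := norm_fourierSeries_le (isRapid_blockEntry g).1
    (abs_pow_mul_norm_blockEntry_le g (n + 1 + 2)) s
  rw [← mul_assoc, mul_right_comm] at h
  exact h

end Synthesis

theorem blockEntry_fourierAnalysis {m : ℤ} (hm : m ≠ 0) :
    blockEntry (fourierAnalysis (toCurveMod Domain.circle ℂ f)) m = jetCoeff f 0 m := by
  rw [blockEntry, if_neg hm, fourierAnalysis_toCurveMod, blockCoeff_apply, if_pos ⟨rfl, hm⟩]

/-- A bound on the second derivative makes the coefficients `O(1 / m²)`, hence absolutely summable,
and a continuous function with summable coefficients is the pointwise sum of its Fourier series. -/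
theorem hasSum_jetCoeff (x : UnitAddCircle) :
    HasSum (fun m => jetCoeff f 0 m * fourier m x) (f.1 x) := by
  let F : UnitAddCircle → ℂ := f.1
  have hc : Continuous F := by
    refine (QuotientAddGroup.isQuotientMap_mk (N := AddSubgroup.zmultiples (1 : ℝ))).continuous_iff.2
      ?_
    have := continuous_jet_circle f 0
    rwa [SmoothMap.jet_zero] at this
  have hco : ∀ m, fourierCoeff (T := 1) (⟨F, hc⟩ : C(UnitAddCircle, ℂ)) m = jetCoeff f 0 m :=
    fun m => (jetCoeff_zero f m).symm
  have hs : Summable (fourierCoeff (T := 1) (⟨F, hc⟩ : C(UnitAddCircle, ℂ))) := by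
    obtain ⟨A, hA⟩ := exists_bound_iterDeriv f 2
    refine Summable.of_norm_bounded_eventually (summable_one_div_sq.mul_left A) ?_
    filter_upwards [(finite_singleton (0 : ℤ)).compl_mem_cofinite] with m hm
    have h1 := abs_pow_mul_norm_jetCoeff_le f m hA
    have h2 := one_le_abs_intCast hm
    rw [hco, mul_one_div, ← sq_abs, le_div_iff₀ (by positivity)]
    linarith
  have h := has_pointwise_sum_fourier_series_of_summable hs x
  simp only [hco, smul_eq_mul] at h
  exact h

/-- Synthesis after analysis returns `f` minus its mean, which is the same curve modulo
translations. -/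
theorem isTame_curveGraded_circle : (curveGraded Domain.circle ℂ).IsTame := by
  refine IsTameSummand.isTame (BoundedContinuousFunction ℤ ℂ)
    ⟨_, _, isTameLinear_fourierAnalysis, isTameLinear_blockSynthesis, fun γ => ?_⟩
  obtain ⟨f, rfl⟩ := toCurveMod_surjective γ
  refine (Submodule.Quotient.eq _).2 ⟨-jetCoeff f 0 0, fun x => ?_⟩
  set d := blockEntry (fourierAnalysis (toCurveMod Domain.circle ℂ f))
  have h1 := (hasSum_jetCoeff f x).sub (hasSum_ite_eq (0 : ℤ) (jetCoeff f 0 0))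
  have h2 : HasSum (fun m => d m * fourier m x) (f.1 x - jetCoeff f 0 0) := by
    refine h1.congr_fun fun m => ?_
    rcases eq_or_ne m 0 with rfl | hm
    · have hy : ∀ y : UnitAddCircle, d 0 * fourier 0 y = jetCoeff f 0 0 * fourier 0 y -
          jetCoeff f 0 0 := fun y => by
        rw [fourier_zero, mul_one, mul_one, sub_self]
        exact if_pos rfl
      rw [if_pos rfl]
      exact hy x
    · rw [if_neg hm, sub_zero]
      exact congrArg (· * _) (blockEntry_fourierAnalysis f hm)
  change (∑' m, d m * fourier m x) - f.1 x = _
  rw [h2.tsum_eq]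
  ring

end Fourier

/-! ### Seeley's reflection coefficients -/

section Reflection

/-- Absolute values of the Taylor coefficients of `∏ (1 - z / 4 ^ j)`. -/
def eulerCoeff : ℕ → ℝ
  | 0 => 1
  | k + 1 => 4 * eulerCoeff k / (4 ^ (k + 1) - 1)

theorem four_pow_succ_sub_one_pos (k : ℕ) : (0 : ℝ) < 4 ^ (k + 1) - 1 :=
  sub_pos.2 (one_lt_pow₀ (by norm_num) (Nat.succ_ne_zero k))

theorem eulerCoeff_pos (k : ℕ) : 0 < eulerCoeff k := by
  induction k with
  | zero => exact one_pos
  | succ k ih => exact div_pos (by linarith) (four_pow_succ_sub_one_pos k)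

theorem eulerCoeff_succ_mul (k : ℕ) :
    eulerCoeff (k + 1) * (4 ^ (k + 1) - 1) = 4 * eulerCoeff k :=
  div_mul_cancel₀ _ (four_pow_succ_sub_one_pos k).ne'

theorem summable_eulerCoeff (z : ℝ) : Summable fun k => eulerCoeff k * z ^ k := by
  refine summable_of_ratio_norm_eventually_le (r := 1 / 2) (by norm_num) ?_
  have ht : Tendsto (fun k : ℕ => (4 : ℝ) ^ k) atTop atTop :=
    tendsto_pow_atTop_atTop_of_one_lt (by norm_num)
  -- The threshold ensures `8 |z| ≤ 4 ^ (k + 1) - 1`, which is exactly a ratio of at most `1 / 2`.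
  filter_upwards [ht.eventually_ge_atTop (2 * |z| + 1)] with k hk
  have h1 := eulerCoeff_succ_mul k
  have h2 := four_pow_succ_sub_one_pos k
  have h3 := eulerCoeff_pos k
  have h4 := eulerCoeff_pos (k + 1)
  rw [norm_mul, norm_mul, norm_pow, norm_pow, Real.norm_eq_abs, Real.norm_eq_abs, Real.norm_eq_abs,
    abs_of_pos h3, abs_of_pos h4, pow_succ, ← mul_assoc, mul_right_comm, ← mul_assoc]
  refine mul_le_mul_of_nonneg_right ?_ (by positivity)
  rw [pow_succ] at h1 h2
  have h5 : 8 * |z| ≤ 4 ^ k * 4 - 1 := by linarith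
  nlinarith [mul_le_mul_of_nonneg_left h5 h4.le]

/-- The function `∏ (1 - z / 4 ^ j)`. -/
def eulerFun (z : ℝ) : ℝ := ∑' k, eulerCoeff k * (-z) ^ k

theorem eulerFun_four_mul (z : ℝ) : eulerFun (4 * z) = (1 - 4 * z) * eulerFun z := by
  have h1 := summable_eulerCoeff (-z)
  have h4 := summable_eulerCoeff (-(4 * z))
  rw [sub_mul, one_mul, eulerFun, eulerFun, h4.tsum_eq_zero_add, ← tsum_mul_left]
  rw [h1.tsum_eq_zero_add, pow_zero, pow_zero, add_sub_assoc,
    ← ((summable_nat_add_iff 1).2 h1).tsum_sub (h1.mul_left _)]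
  congr 1
  refine tsum_congr fun k => ?_
  have h := eulerCoeff_succ_mul k
  have e : (-(4 * z)) ^ (k + 1) = 4 ^ (k + 1) * (-z) ^ (k + 1) := by rw [← mul_pow]; ring
  rw [e, pow_succ (-z)]
  linear_combination (-z) ^ k * (-z) * h

theorem eulerFun_four_pow (n : ℕ) : eulerFun (4 ^ n) = 0 := by
  induction n with
  | zero =>
    -- The factor `1 - 4z` vanishes at `z = 1 / 4`, which gives the zero at `1`; the functional
    -- equation then propagates it to all powers of `4`.
    have h := eulerFun_four_mul (1 / 4)
    norm_num at h
    simpa using h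
  | succ n ih => rw [pow_succ', eulerFun_four_mul, ih, mul_zero]

/-- There are coefficients of rapid decay with `∑ aₖ (-4ᵏ)ⁿ = 1` for all `n`. -/
theorem exists_reflection_coefficients : ∃ a : ℕ → ℝ,
    (∀ n, Summable fun k => |a k| * (4 ^ k) ^ n) ∧ ∀ n, ∑' k, a k * (-4 ^ k) ^ n = 1 := by
  -- With `E` the Euler function, these coefficients solve `A (4z) + A z = E z` for `A z = ∑ cₖ
  -- (-z)ᵏ`. As `E` vanishes at the powers of `4`, `A (4ⁿ) = (-1)ⁿ A 1`. Taking `aₖ = (-1)ᵏ cₖ / A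
  -- 1` and exchanging `(4ᵏ)ⁿ = (4ⁿ)ᵏ` makes the `n`-th moment `(-1)ⁿ A (4ⁿ) / A 1 = 1`.
  let c : ℕ → ℝ := fun k => eulerCoeff k / (4 ^ k + 1)
  have hc : ∀ k, 0 < c k := fun k => div_pos (eulerCoeff_pos k) (by positivity)
  have hce : ∀ k, c k * (4 ^ k + 1) = eulerCoeff k := fun k => div_mul_cancel₀ _ (by positivity)
  have hcle : ∀ k, c k ≤ eulerCoeff k := fun k =>
    div_le_self (eulerCoeff_pos k).le (le_add_of_nonneg_left (by positivity))
  have hs : ∀ z : ℝ, Summable fun k => c k * z ^ k := fun z => by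
    refine Summable.of_norm_bounded (summable_eulerCoeff |z|) fun k => ?_
    rw [norm_mul, norm_pow, Real.norm_eq_abs, Real.norm_eq_abs, abs_of_pos (hc k)]
    exact mul_le_mul_of_nonneg_right (hcle k) (by positivity)
  let A : ℝ → ℝ := fun z => ∑' k, c k * (-z) ^ k
  have hA : ∀ z, A (4 * z) + A z = eulerFun z := fun z => by
    rw [← (hs _).tsum_add (hs _)]
    refine tsum_congr fun k => ?_
    have e : (-(4 * z)) ^ k = 4 ^ k * (-z) ^ k := by rw [← mul_pow]; ring
    rw [e, ← hce]
    ring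
  have hAn : ∀ n : ℕ, A (4 ^ n) = (-1) ^ n * A 1 := fun n => by
    induction n with
    | zero => simp
    | succ n ih =>
      have h := hA (4 ^ n)
      rw [eulerFun_four_pow, ← pow_succ'] at h
      rw [pow_succ (-1 : ℝ), mul_neg_one, neg_mul, ← ih]
      linarith
  have hanti : Antitone c := antitone_nat_of_succ_le fun k => by
    have h := eulerCoeff_succ_mul k
    rw [← hce k, ← hce (k + 1)] at h
    have h4 : (1 : ℝ) ≤ 4 ^ k := one_le_pow₀ (by norm_num)
    rw [pow_succ] at h
    have h5 : 4 * ((4 : ℝ) ^ k + 1) ≤ (4 ^ k * 4 + 1) * (4 ^ k * 4 - 1) := by nlinarith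
    have h6 : (0 : ℝ) < (4 ^ k * 4 + 1) * (4 ^ k * 4 - 1) := by nlinarith
    refine le_of_mul_le_mul_right ?_ h6
    rw [← mul_assoc, h, mul_left_comm]
    exact mul_le_mul_of_nonneg_left h5 (hc k).le
  -- The series at `1` is alternating with decreasing terms, so it is at least `c 0 - c 1 = 1/2 -
  -- 4/15`.
  have hA1 : 0 < A 1 := by
    have h1 : Tendsto (fun n => ∑ i ∈ Finset.range n, (-1) ^ i * c i) atTop (𝓝 (A 1)) := by
      refine ((hs (-1)).hasSum.tendsto_sum_nat).congr fun n => ?_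
      exact Finset.sum_congr rfl fun i _ => mul_comm _ _
    refine lt_of_lt_of_le ?_ (hanti.alternating_series_le_tendsto h1 1)
    norm_num [Finset.sum_range_succ, c, eulerCoeff]
  refine ⟨fun k => (-1) ^ k * c k / A 1, fun n => ?_, fun n => ?_⟩
  · refine ((hs (4 ^ n)).div_const (A 1)).congr fun k => ?_
    rw [abs_div, abs_mul, abs_pow, abs_neg, abs_one, one_pow, one_mul, abs_of_pos (hc k),
      abs_of_pos hA1, ← pow_mul, ← pow_mul, mul_comm k n]
    ring
  · have h : ∀ k, (-1) ^ k * c k / A 1 * (-4 ^ k) ^ n =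
        (-1) ^ n / A 1 * (c k * (-4 ^ n) ^ k) := fun k => by
      rw [neg_pow (4 ^ k : ℝ), neg_pow (4 ^ n : ℝ), ← pow_mul, ← pow_mul, mul_comm k n]
      ring
    rw [tsum_congr h, tsum_mul_left]
    change (-1) ^ n / A 1 * A (4 ^ n) = 1
    rw [hAn, div_mul_eq_mul_div, ← mul_assoc, ← mul_pow]
    simp [hA1.ne']

/-- Seeley's reflection coefficients. -/
def reflCoeff : ℕ → ℝ := exists_reflection_coefficients.choose

theorem summable_reflCoeff (n : ℕ) : Summable fun k => |reflCoeff k| * (4 ^ k) ^ n :=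
  exists_reflection_coefficients.choose_spec.1 n

theorem tsum_reflCoeff (n : ℕ) : ∑' k, reflCoeff k * (-4 ^ k) ^ n = 1 :=
  exists_reflection_coefficients.choose_spec.2 n

end Reflection

/-! ### Extension of smooth functions across the boundary point of a half-line -/

section HalfLine

variable {V : Type} [NormedAddCommGroup V] [NormedSpace ℝ V]

/-- The derivatives of a smooth function on the half-line `x ≥ 0` which is supported in
`[0, 2/3]`, continued by constants to the negative numbers. -/
structure IsHalfTower (G : ℕ → ℝ → V) : Prop where
  bounded : ∀ n, ∃ B, ∀ x, ‖G n x‖ ≤ B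
  continuous : ∀ n, Continuous (G n)
  const : ∀ n, ∀ x ≤ 0, G n x = G n 0
  vanish : ∀ n, ∀ x > 2 / 3, G n x = 0
  hasDerivAt : ∀ n, ∀ x > 0, HasDerivAt (G n) (G (n + 1) x) x

/-- The `n`-th derivative of Seeley's extension. -/
def seeley (G : ℕ → ℝ → V) (n : ℕ) (x : ℝ) : V :=
  G n x - G n 0 + ∑' k, (reflCoeff k * (-4 ^ k) ^ n) • G n (-4 ^ k * x)

variable {G : ℕ → ℝ → V}

theorem norm_seeley_term_le {n : ℕ} {B : ℝ} (hB : ∀ x, ‖G n x‖ ≤ B) (x : ℝ) (k m : ℕ) :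
    ‖(reflCoeff k * (-4 ^ k) ^ m) • G n x‖ ≤ |reflCoeff k| * (4 ^ k) ^ m * B := by
  rw [norm_smul, norm_mul, norm_pow, norm_neg, norm_pow, Real.norm_eq_abs, Real.norm_eq_abs,
    abs_of_pos (by norm_num : (0 : ℝ) < 4)]
  exact mul_le_mul_of_nonneg_left (hB x) (by positivity)

theorem norm_seeley_le {n : ℕ} {B : ℝ} (hB : ∀ x, ‖G n x‖ ≤ B) (x : ℝ) :
    ‖seeley G n x‖ ≤ (2 + ∑' k, |reflCoeff k| * (4 ^ k) ^ n) * B := by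
  have h1 := tsum_of_norm_bounded ((summable_reflCoeff n).hasSum.mul_right B)
    fun k => norm_seeley_term_le hB (-4 ^ k * x) k n
  have h2 := norm_add_le (G n x - G n 0) (∑' k, (reflCoeff k * (-4 ^ k) ^ n) • G n (-4 ^ k * x))
  have h3 := norm_sub_le (G n x) (G n 0)
  rw [seeley]
  linarith [hB x, hB 0]

/-- The `n`-th derivative of the periodic function obtained from Seeley's extension, rescaled to
the period `1`. -/
def periodized (G : ℕ → ℝ → V) (n : ℕ) (t : ℝ) : V :=
  (3 : ℝ) ^ n • seeley G n (3 * Int.fract t - 1)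

theorem periodic_periodized (G : ℕ → ℝ → V) (n : ℕ) : Function.Periodic (periodized G n) 1 :=
  fun t => by rw [periodized, periodized, Int.fract_add_one]

theorem IsHalfTower.summable [CompleteSpace V] (hG : IsHalfTower G) (n : ℕ) (x : ℝ) :
    Summable fun k => (reflCoeff k * (-4 ^ k) ^ n) • G n (-4 ^ k * x) := by
  obtain ⟨B, hB⟩ := hG.bounded n
  exact Summable.of_norm_bounded ((summable_reflCoeff n).mul_right B)
    fun k => norm_seeley_term_le hB _ k n

/-- For `x ≥ 0` all reflected arguments are nonpositive, where `G n` is constant; the moment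
condition turns the sum into `G n 0`, cancelling the subtracted term. For `x < 0` it is instead `G n
x - G n 0` that vanishes, so one formula serves both sides. -/
theorem IsHalfTower.seeley_of_nonneg (hG : IsHalfTower G) (n : ℕ) {x : ℝ} (hx : 0 ≤ x) :
    seeley G n x = G n x := by
  have h : ∀ k, (reflCoeff k * (-4 ^ k) ^ n) • G n (-4 ^ k * x) =
      (reflCoeff k * (-4 ^ k) ^ n) • G n 0 := fun k => by
    rw [hG.const n _ (by rw [neg_mul, neg_nonpos]; positivity)]
  have hs : Summable fun k => reflCoeff k * (-4 ^ k) ^ n :=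
    Summable.of_norm_bounded (summable_reflCoeff n) fun k => by simp
  rw [seeley, tsum_congr h, hs.tsum_smul_const, tsum_reflCoeff, one_smul, sub_add_cancel]

/-- Since `4 ^ k ≥ 1`, reflection only pushes arguments further out of the support. The resulting
support lies well inside `[-1, 2)`, which allows periodization with period `3`. -/
theorem IsHalfTower.seeley_eq_zero (hG : IsHalfTower G) (n : ℕ) {x : ℝ} (hx : 2 / 3 < |x|) :
    seeley G n x = 0 := by
  rcases le_or_gt 0 x with h0 | h0
  · rw [hG.seeley_of_nonneg n h0]
    exact hG.vanish n x (by rwa [abs_of_nonneg h0] at hx)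
  · rw [abs_of_neg h0] at hx
    have h : ∀ k, (reflCoeff k * (-4 ^ k) ^ n) • G n (-4 ^ k * x) = 0 := fun k => by
      have h4 : (1 : ℝ) ≤ 4 ^ k := one_le_pow₀ (by norm_num)
      rw [hG.vanish n _ (by nlinarith), smul_zero]
    rw [seeley, tsum_congr h, tsum_zero, hG.const n x h0.le, sub_self, add_zero]

variable [CompleteSpace V]

theorem IsHalfTower.continuous_seeley (hG : IsHalfTower G) (n : ℕ) : Continuous (seeley G n) := by
  obtain ⟨B, hB⟩ := hG.bounded n
  refine ((hG.continuous n).sub continuous_const).add (continuous_tsum (fun k => ?_)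
    ((summable_reflCoeff n).mul_right B) fun k x => norm_seeley_term_le hB _ k n)
  exact ((hG.continuous n).comp (continuous_const.mul continuous_id)).const_smul _

/-- Off the origin the formula is differentiated directly, termwise on the left. At the origin no
computation is needed: the function and its would-be derivative are continuous there, so the
derivative extends across the point. -/
theorem IsHalfTower.hasDerivAt_seeley (hG : IsHalfTower G) (n : ℕ) (x : ℝ) :
    HasDerivAt (seeley G n) (seeley G (n + 1) x) x := by
  have hne : ∀ y ≠ 0, HasDerivAt (seeley G n) (seeley G (n + 1) y) y := fun y hy => by
    rcases hy.lt_or_gt with hy | hy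
    · obtain ⟨B, hB⟩ := hG.bounded (n + 1)
      have hterm : ∀ k : ℕ, ∀ z ∈ Iio (0 : ℝ), HasDerivAt
          (fun z => (reflCoeff k * (-4 ^ k) ^ n) • G n (-4 ^ k * z))
          ((reflCoeff k * (-4 ^ k) ^ (n + 1)) • G (n + 1) (-4 ^ k * z)) z := fun k z hz => by
        have hz0 : 0 < -4 ^ k * z := mul_pos_of_neg_of_neg (by simp) hz
        have h1 : HasDerivAt (fun z : ℝ => -4 ^ k * z) (-4 ^ k) z := by
          simpa using (hasDerivAt_id z).const_mul (-4 ^ k : ℝ)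
        refine (((hG.hasDerivAt n _ hz0).scomp z h1).const_smul
          (reflCoeff k * (-4 ^ k) ^ n)).congr_deriv ?_
        rw [smul_smul, pow_succ, mul_assoc]
      have h := hasDerivAt_tsum_of_isPreconnected ((summable_reflCoeff (n + 1)).mul_right B)
        isOpen_Iio isPreconnected_Iio hterm (fun k z _ => norm_seeley_term_le hB _ k (n + 1))
        hy (hG.summable n y) hy
      have hc : HasDerivAt (fun z => G n z - G n 0) (G (n + 1) y - G (n + 1) 0) y := by
        rw [hG.const (n + 1) y hy.le, sub_self]
        refine (hasDerivAt_const y (0 : V)).congr_of_eventuallyEq ?_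
        filter_upwards [Iio_mem_nhds hy] with z hz
        rw [hG.const n z (le_of_lt hz), sub_self]
      exact hc.add h
    · rw [hG.seeley_of_nonneg (n + 1) hy.le]
      refine (hG.hasDerivAt n y hy).congr_of_eventuallyEq ?_
      filter_upwards [Ioi_mem_nhds hy] with z hz
      exact hG.seeley_of_nonneg n (le_of_lt hz)
  exact hasDerivAt_of_hasDerivAt_of_ne' hne (hG.continuous_seeley n).continuousAt
    (hG.continuous_seeley (n + 1)).continuousAt x

theorem IsHalfTower.hasDerivAt_periodized (hG : IsHalfTower G) (n : ℕ) (t : ℝ) :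
    HasDerivAt (periodized G n) (periodized G (n + 1) t) t := by
  set m := ⌊t⌋
  rcases (Int.floor_le t).eq_or_lt with h0 | h0
  · have hz : ∀ n, periodized G n =ᶠ[𝓝 t] fun _ => 0 := fun n => by
      -- At an integer the rescaled argument jumps from `2` to `-1`. Within `1 / 9` it stays above
      -- `5 / 3` or below `-2 / 3`, where the extension vanishes.
      filter_upwards [Ioo_mem_nhds (show t - 1 / 9 < t by linarith)
        (show t < t + 1 / 9 by linarith)] with y hy
      rw [periodized, hG.seeley_eq_zero n, smul_zero]
      rcases lt_or_ge y t with hyt | hyt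
      · have hf : ⌊y⌋ = m - 1 := Int.floor_eq_iff.2 ⟨by push_cast; linarith [hy.1], by
          push_cast; linarith⟩
        rw [Int.fract, hf, lt_abs]
        left
        push_cast
        linarith [hy.1]
      · have hf : ⌊y⌋ = m := Int.floor_eq_iff.2 ⟨by linarith, by linarith [hy.2]⟩
        rw [Int.fract, hf, lt_abs]
        right
        linarith [hy.2]
    rw [(hz (n + 1)).eq_of_nhds]
    exact (hasDerivAt_const t (0 : V)).congr_of_eventuallyEq (hz n)
  · have hf : ∀ y ∈ Ioo (m : ℝ) (m + 1), Int.fract y = y - m := fun y hy => by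
      rw [Int.fract, Int.floor_eq_iff.2 ⟨hy.1.le, hy.2⟩]
    have ht : t ∈ Ioo (m : ℝ) (m + 1) := ⟨h0, Int.lt_floor_add_one t⟩
    have h1 : HasDerivAt (fun y : ℝ => 3 * (y - m) - 1) 3 t := by
      simpa using (((hasDerivAt_id t).sub_const (m : ℝ)).const_mul 3).sub_const 1
    have h2 := ((hG.hasDerivAt_seeley n _).scomp t h1).const_smul ((3 : ℝ) ^ n)
    rw [periodized, hf t ht, pow_succ, mul_smul]
    refine h2.congr_of_eventuallyEq ?_
    filter_upwards [Ioo_mem_nhds ht.1 ht.2] with y hy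
    rw [periodized, hf y hy]
    rfl

end HalfLine

/-! ### The extension operator on the interval -/

section Extension

variable {V : Type} [NormedAddCommGroup V] [NormedSpace ℝ V]

/-- A smooth cutoff, equal to `1` near `0` and to `0` near `1`. -/
def cutoff (x : ℝ) : ℝ := Real.smoothTransition (2 - 3 * x)

theorem contDiff_cutoff : ContDiff ℝ ∞ cutoff :=
  (Real.smoothTransition.contDiff (n := ⊤)).comp
    (contDiff_const.sub (contDiff_const.mul contDiff_id))

theorem cutoff_eq_zero {x : ℝ} (hx : 2 / 3 < x) : cutoff x = 0 :=
  Real.smoothTransition.zero_of_nonpos (by linarith)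

/-- The two arguments of `Real.smoothTransition` add up to `1`. The resulting partition of unity
splits a function into one piece per end point. -/
theorem cutoff_add_cutoff (x : ℝ) : cutoff x + cutoff (1 - x) = 1 := by
  have h := Real.smoothTransition.pos_denom (2 - 3 * x)
  have e : 2 - 3 * (1 - x) = 1 - (2 - 3 * x) := by ring
  rw [cutoff, cutoff, e, Real.smoothTransition, Real.smoothTransition, sub_sub_cancel,
    add_comm (expNegInvGlue (1 - (2 - 3 * x))), ← add_div]
  exact div_self h.ne'

theorem proj_interval {x : ℝ} (hx : x ∈ Icc (0 : ℝ) 1) : Domain.interval.proj x = ⟨x, hx⟩ :=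
  projIcc_of_mem zero_le_one hx

/-- Multiplication by the cutoff. -/
def cutoffMul : SmoothMap Domain.interval V →ₗ[ℝ] SmoothMap Domain.interval V where
  toFun f := ⟨fun p : unitInterval => cutoff p • f.1 p, by
    refine (contDiff_cutoff.contDiffOn.smul (g := f.1 ∘ Domain.interval.proj) f.2).congr
      fun x hx => ?_
    refine (congrArg (fun p : unitInterval => cutoff p • f.1 p) (proj_interval hx)).trans ?_
    exact congrArg (cutoff x • f.1 ·) (proj_interval hx).symm⟩
  map_add' f g := Subtype.ext (funext fun p : unitInterval => smul_add (cutoff p) (f.1 p) (g.1 p))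
  map_smul' c f := Subtype.ext (funext fun p : unitInterval =>
    smul_comm (cutoff p) c (f.1 p))

theorem jet_zero_cutoffMul (f : SmoothMap Domain.interval V) {x : ℝ} (hx : x ∈ Icc (0 : ℝ) 1) :
    (cutoffMul f).jet 0 x = cutoff x • f.jet 0 x := by
  rw [SmoothMap.jet_zero, SmoothMap.jet_zero]
  refine (congrArg (fun p : unitInterval => cutoff p • f.1 p) (proj_interval hx)).trans ?_
  exact congrArg (cutoff x • f.1 ·) (proj_interval hx).symm

/-- Leibniz's formula, with the derivatives of the cutoff bounded by compactness, so that the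
constant is uniform in `f`. -/
theorem exists_bound_iterDeriv_cutoffMul (n : ℕ) : ∃ C : ℝ, 0 ≤ C ∧
    ∀ (f : SmoothMap Domain.interval V) (A : ℝ),
      (∀ j ≤ n, ∀ s, ‖iterDeriv Domain.interval V j f s‖ ≤ A) →
      ∀ s, ‖iterDeriv Domain.interval V n (cutoffMul f) s‖ ≤ C * A := by
  have hu := Domain.interval.uniqueDiffOn_param
  have hK : ∀ i : ℕ, ∃ K, ∀ x ∈ Icc (0 : ℝ) 1,
      ‖iteratedFDerivWithin ℝ i cutoff (Icc (0 : ℝ) 1) x‖ ≤ K := fun i =>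
    isCompact_Icc.exists_bound_of_continuousOn
      (contDiff_cutoff.contDiffOn.continuousOn_iteratedFDerivWithin (by exact_mod_cast le_top) hu)
  choose K hK using hK
  have hK0 : ∀ i, 0 ≤ K i := fun i => (norm_nonneg _).trans (hK i 0 ⟨le_rfl, zero_le_one⟩)
  refine ⟨∑ i ∈ Finset.range (n + 1), (n.choose i : ℝ) * K i,
    Finset.sum_nonneg fun i _ => mul_nonneg (Nat.cast_nonneg _) (hK0 i), fun f A hA s => ?_⟩
  have h := norm_iteratedFDerivWithin_smul_le (n := n)
    (contDiff_cutoff.contDiffOn (s := Icc (0 : ℝ) 1))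
    (g := f.jet 0) (N := ∞) (by rw [SmoothMap.jet_zero]; exact f.2) hu s.2
    (by exact_mod_cast le_top)
  have e : iterDeriv Domain.interval V n (cutoffMul f) s =
      iteratedDerivWithin n (fun x => cutoff x • f.jet 0 x) (Icc (0 : ℝ) 1) s := by
    refine iteratedDerivWithin_congr (fun x hx => ?_) s.2
    rw [← jet_zero_cutoffMul f hx, SmoothMap.jet_zero]
  rw [e, ← norm_iteratedFDerivWithin_eq_norm_iteratedDerivWithin, Finset.sum_mul]
  refine h.trans (Finset.sum_le_sum fun i hi => ?_)
  have h2 : ‖iteratedFDerivWithin ℝ (n - i) (f.jet 0) (Icc (0 : ℝ) 1) s‖ ≤ A := by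
    rw [norm_iteratedFDerivWithin_eq_norm_iteratedDerivWithin, SmoothMap.jet_zero]
    exact hA (n - i) (Nat.sub_le _ _) s
  exact mul_le_mul (mul_le_mul_of_nonneg_left (hK i s s.2) (Nat.cast_nonneg _)) h2 (norm_nonneg _)
    (mul_nonneg (Nat.cast_nonneg _) (hK0 i))

theorem jet_cutoffMul_eq_zero (f : SmoothMap Domain.interval V) (n : ℕ) {x : ℝ}
    (hx : x ∈ Ioc (2 / 3 : ℝ) 1) : (cutoffMul f).jet n x = 0 := by
  induction n generalizing x with
  | zero =>
    rw [jet_zero_cutoffMul f ⟨by linarith [hx.1], hx.2⟩, cutoff_eq_zero hx.1, zero_smul]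
  | succ n ih =>
    have hx' : x ∈ Icc (0 : ℝ) 1 := ⟨by linarith [hx.1], hx.2⟩
    have h1 := (cutoffMul f).hasDerivWithinAt_jet n hx'
    refine (Domain.interval.uniqueDiffOn_param x hx').eq_deriv _ h1 ?_
    refine (hasDerivWithinAt_const x (Icc (0 : ℝ) 1) (0 : V)).congr_of_eventuallyEq ?_ (ih hx)
    filter_upwards [self_mem_nhdsWithin, mem_nhdsWithin_of_mem_nhds (Ioi_mem_nhds hx.1)]
      with y hy hy'
    exact ih ⟨hy', hy.2⟩

/-- The derivatives of the cut off function, continued by constants. -/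
def cutoffTower (f : SmoothMap Domain.interval V) (n : ℕ) (x : ℝ) : V :=
  iterDeriv Domain.interval V n (cutoffMul f) (projIcc 0 1 zero_le_one x)

theorem cutoffTower_eq_jet (f : SmoothMap Domain.interval V) (n : ℕ) {x : ℝ}
    (hx : x ∈ Icc (0 : ℝ) 1) : cutoffTower f n x = (cutoffMul f).jet n x := by
  rw [cutoffTower, projIcc_of_mem zero_le_one hx, SmoothMap.iterDeriv_apply]

theorem isHalfTower_cutoffTower (f : SmoothMap Domain.interval V) :
    IsHalfTower (cutoffTower f) := by
  have hv : ∀ n, ∀ x > 2 / 3, cutoffTower f n x = 0 := fun n x hx => by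
    rcases le_or_gt x 1 with h1 | h1
    · rw [cutoffTower_eq_jet f n ⟨by linarith, h1⟩]
      exact jet_cutoffMul_eq_zero f n ⟨hx, h1⟩
    · rw [cutoffTower, projIcc_of_right_le zero_le_one h1.le, SmoothMap.iterDeriv_apply]
      exact jet_cutoffMul_eq_zero f n ⟨by norm_num, le_rfl⟩
  refine ⟨fun n => ?_, fun n => ?_, fun n x hx => ?_, hv, fun n x hx => ?_⟩
  · obtain ⟨B, hB⟩ := exists_bound_iterDeriv (cutoffMul f) n
    exact ⟨B, fun x => hB _⟩
  · exact (((cutoffMul f).continuousOn_jet n).comp_continuous continuous_subtype_val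
      Domain.interval.mem_param).comp continuous_projIcc
  · rw [cutoffTower, cutoffTower, projIcc_of_le_left zero_le_one hx,
      projIcc_of_le_left zero_le_one le_rfl]
  · rcases lt_or_ge x 1 with h1 | h1
    · have hn : Icc (0 : ℝ) 1 ∈ 𝓝 x := Icc_mem_nhds hx h1
      rw [cutoffTower_eq_jet f _ ⟨hx.le, h1.le⟩]
      refine (((cutoffMul f).hasDerivWithinAt_jet n
        (show x ∈ Icc (0 : ℝ) 1 from ⟨hx.le, h1.le⟩)).hasDerivAt hn).congr_of_eventuallyEq ?_
      filter_upwards [hn] with y hy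
      exact cutoffTower_eq_jet f n hy
    -- For `x ≥ 1` the continued function is locally zero, because the cutoff already vanishes
    -- beyond `2 / 3`.
    · rw [hv (n + 1) x (by linarith)]
      refine (hasDerivAt_const x (0 : V)).congr_of_eventuallyEq ?_
      filter_upwards [Ioi_mem_nhds (show 2 / 3 < x by linarith)] with y hy
      exact hv n y hy

/-- The constant map. -/
def constMap (I : Domain) : V →ₗ[ℝ] SmoothMap I V where
  toFun v := ⟨fun _ => v, contDiffOn_const⟩
  map_add' _ _ := rfl
  map_smul' _ _ := rfl

/-- Translation of the initial point to the origin. -/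
def center : SmoothMap Domain.interval V →ₗ[ℝ] SmoothMap Domain.interval V :=
  LinearMap.id - constMap Domain.interval ∘ₗ
    (LinearMap.proj (R := ℝ) (φ := fun _ : unitInterval => V) 0 ∘ₗ
      (smoothSubmodule Domain.interval V).subtype)

theorem toCurveMod_center (f : SmoothMap Domain.interval V) :
    toCurveMod Domain.interval V (center f) = toCurveMod Domain.interval V f :=
  (Submodule.Quotient.eq _).2 ⟨-f.1 (0 : unitInterval), fun p => by
    change f.1 p - f.1 (0 : unitInterval) - f.1 p = _
    abel⟩

/-- The seminorms modulo translations ignore order zero, but the cutoff brings undifferentiated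
values into play. Once the initial value is zero, the mean value inequality on an interval of length
one bounds them by the first derivative. -/
theorem norm_iterDeriv_center_le (f : SmoothMap Domain.interval V) {j n : ℕ} (hj : j ≤ n + 1)
    (s : unitInterval) : ‖iterDeriv Domain.interval V j (center f) s‖ ≤
      (curveGraded Domain.interval V).seminorm (n + 1) (toCurveMod Domain.interval V f) := by
  set A := (curveGraded Domain.interval V).seminorm (n + 1) (toCurveMod Domain.interval V f)
  rcases j with _ | j
  · have h1 := (convex_Icc (0 : ℝ) 1).norm_image_sub_le_of_norm_hasDerivWithin_le (C := A)
      (fun x hx => f.hasDerivWithinAt_jet 0 hx)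
      (fun x hx => norm_iterDeriv_succ_le (Nat.succ_pos n) f ⟨x, hx⟩)
      (show (0 : ℝ) ∈ Icc (0 : ℝ) 1 from ⟨le_rfl, zero_le_one⟩) s.2
    have h2 : iterDeriv Domain.interval V 0 (center f) s = f.jet 0 s - f.jet 0 0 := by
      rw [SmoothMap.iterDeriv_apply, SmoothMap.jet_zero, SmoothMap.jet_zero]
      change f.1 (Domain.interval.proj s) - f.1 (0 : unitInterval) =
        f.1 (Domain.interval.proj s) - f.1 (Domain.interval.proj 0)
      rw [proj_interval (x := 0) ⟨le_rfl, zero_le_one⟩]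
      rfl
    rw [h2]
    refine h1.trans (mul_le_of_le_one_right (apply_nonneg _ _) ?_)
    rw [sub_zero, Real.norm_of_nonneg s.2.1]
    exact s.2.2
  · have := norm_iterDeriv_succ_le (Nat.lt_of_succ_le hj) (center f) s
    rwa [toCurveMod_center] at this

variable [CompleteSpace V]

/-- The one-sided extension operator, from functions on the interval to periodic functions. -/
def halfExtend : SmoothMap Domain.interval V →ₗ[ℝ] SmoothMap Domain.circle V where
  toFun f := ⟨(periodic_periodized (cutoffTower f) 0).lift,
    contDiffOn_of_tower (F := periodized (cutoffTower f)) Domain.circle.uniqueDiffOn_param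
      (fun t _ => rfl)
      fun n x _ => ((isHalfTower_cutoffTower f).hasDerivAt_periodized n x).hasDerivWithinAt⟩
  map_add' f g := by
    refine Subtype.ext (funext fun x => ?_)
    obtain ⟨t, rfl⟩ := QuotientAddGroup.mk_surjective x
    have hl : ∀ x, cutoffTower (f + g) 0 x = cutoffTower f 0 x + cutoffTower g 0 x := fun x => by
      rw [cutoffTower, map_add, map_add]
      rfl
    change periodized (cutoffTower (f + g)) 0 t =
      periodized (cutoffTower f) 0 t + periodized (cutoffTower g) 0 t
    simp only [periodized, seeley, hl, smul_add]
    rw [((isHalfTower_cutoffTower f).summable 0 _).tsum_add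
      ((isHalfTower_cutoffTower g).summable 0 _)]
    module
  map_smul' c f := by
    refine Subtype.ext (funext fun x => ?_)
    obtain ⟨t, rfl⟩ := QuotientAddGroup.mk_surjective x
    have hl : ∀ x, cutoffTower (c • f) 0 x = c • cutoffTower f 0 x := fun x => by
      rw [cutoffTower, map_smul, map_smul]
      rfl
    change periodized (cutoffTower (c • f)) 0 t = c • periodized (cutoffTower f) 0 t
    simp only [periodized, seeley, hl, smul_comm _ c]
    rw [tsum_const_smul'' c]
    module

theorem iterDeriv_halfExtend (f : SmoothMap Domain.interval V) (n : ℕ) (s : unitInterval) :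
    iterDeriv Domain.circle V n (halfExtend f) s = periodized (cutoffTower f) n s :=
  SmoothMap.jet_eqOn_of_tower (halfExtend f) (F := periodized (cutoffTower f)) (fun _ _ => rfl)
    (fun n x _ => ((isHalfTower_cutoffTower f).hasDerivAt_periodized n x).hasDerivWithinAt) n
    (Domain.circle.mem_param s)

theorem exists_bound_iterDeriv_halfExtend (n : ℕ) : ∃ C : ℝ,
    ∀ (f : SmoothMap Domain.interval V) (A : ℝ),
      (∀ j ≤ n, ∀ s, ‖iterDeriv Domain.interval V j f s‖ ≤ A) →
      ∀ s, ‖iterDeriv Domain.circle V n (halfExtend f) s‖ ≤ C * A := by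
  obtain ⟨C, hC0, hC⟩ := exists_bound_iterDeriv_cutoffMul (V := V) n
  refine ⟨3 ^ n * ((2 + ∑' k, |reflCoeff k| * (4 ^ k) ^ n) * C), fun f A hA s => ?_⟩
  rw [iterDeriv_halfExtend, periodized, norm_smul, norm_pow, Real.norm_eq_abs,
    abs_of_pos (by norm_num : (0 : ℝ) < 3), mul_assoc, mul_assoc]
  exact mul_le_mul_of_nonneg_left (norm_seeley_le (fun x => hC f A hA _) _) (by positivity)

/-- The parameter `(1 + s) / 3` inverts the rescaling `t ↦ 3t - 1`, so the interval occupies the arc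
from `1/3` to `2/3`. -/
theorem halfExtend_apply (f : SmoothMap Domain.interval V) (s : unitInterval) :
    (halfExtend f).1 (((1 + s) / 3 : ℝ) : UnitAddCircle) = cutoff s • f.1 s := by
  change periodized (cutoffTower f) 0 ((1 + s) / 3) = _
  have hf : Int.fract ((1 + s : ℝ) / 3) = (1 + s) / 3 :=
    Int.fract_eq_self.2 ⟨by linarith [s.2.1], by linarith [s.2.2]⟩
  have e : (3 : ℝ) * ((1 + s) / 3) - 1 = s := by ring
  rw [periodized, pow_zero, one_smul, hf, e, (isHalfTower_cutoffTower f).seeley_of_nonneg 0 s.2.1,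
    cutoffTower_eq_jet f 0 s.2, jet_zero_cutoffMul f s.2, SmoothMap.jet_zero]
  exact congrArg (cutoff s • f.1 ·) (proj_interval s.2)

/-- Reversal of the interval. -/
def reverseInterval : SmoothMap Domain.interval V →ₗ[ℝ] SmoothMap Domain.interval V :=
  SmoothMap.pullback (I := Domain.interval) (I' := Domain.interval) (-1) 1 unitInterval.symm
    (fun t ht => ⟨by linarith [ht.2], by linarith [ht.1]⟩) fun t ht => by
      rw [proj_interval ht, proj_interval ⟨by linarith [ht.2], by linarith [ht.1]⟩]
      refine Subtype.ext ?_
      change 1 - t = -1 * t + 1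
      ring

/-- Reversal of the circle. -/
def reverseCircle : SmoothMap Domain.circle V →ₗ[ℝ] SmoothMap Domain.circle V :=
  SmoothMap.pullback (I := Domain.circle) (I' := Domain.circle) (-1) 0
    (fun x : UnitAddCircle => -x) (fun _ _ => mem_univ _) fun t _ => by
      change -(t : UnitAddCircle) = ((-1 * t + 0 : ℝ) : UnitAddCircle)
      rw [neg_one_mul, add_zero, AddCircle.coe_neg]

/-- Restriction to an arc of the circle. -/
def restrictArc : SmoothMap Domain.circle V →ₗ[ℝ] SmoothMap Domain.interval V :=
  SmoothMap.pullback (I := Domain.circle) (I' := Domain.interval) (1 / 3) (1 / 3)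
    (fun s : unitInterval => (((1 + s) / 3 : ℝ) : UnitAddCircle)) (fun _ _ => mem_univ _)
    fun t ht => by
      rw [proj_interval ht]
      refine congrArg (fun x : ℝ => (x : UnitAddCircle)) ?_
      change (1 + t) / 3 = 1 / 3 * t + 1 / 3
      ring

/-- The extension operator, from functions on the interval to periodic functions. -/
def extend : SmoothMap Domain.interval V →ₗ[ℝ] SmoothMap Domain.circle V :=
  halfExtend + reverseCircle ∘ₗ halfExtend ∘ₗ reverseInterval

/-- Negation on the circle preserves the arc, since `-(1 + s) / 3` is `(1 + (1 - s)) / 3` modulo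
`1`, and acts on it as `s ↦ 1 - s`. The two one-sided pieces therefore add up to `f` by the
partition of unity. -/
theorem restrictArc_extend (f : SmoothMap Domain.interval V) : restrictArc (extend f) = f := by
  refine Subtype.ext (funext fun s : unitInterval => ?_)
  change (halfExtend f).1 (((1 + s) / 3 : ℝ) : UnitAddCircle) +
    (halfExtend (reverseInterval f)).1 (-(((1 + s) / 3 : ℝ) : UnitAddCircle)) = f.1 s
  have e : -(((1 + s) / 3 : ℝ) : UnitAddCircle) =
      (((1 + (unitInterval.symm s : unitInterval)) / 3 : ℝ) : UnitAddCircle) := by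
    rw [← AddCircle.coe_neg, ← AddCircle.coe_add_period 1, unitInterval.coe_symm_eq]
    congr 1
    ring
  rw [e, halfExtend_apply, halfExtend_apply]
  change cutoff s • f.1 s + cutoff (unitInterval.symm s) •
    f.1 (unitInterval.symm (unitInterval.symm s)) = f.1 s
  rw [unitInterval.symm_symm, ← add_smul, unitInterval.coe_symm_eq, cutoff_add_cutoff, one_smul]

theorem exists_bound_iterDeriv_extend (n : ℕ) : ∃ C : ℝ,
    ∀ (f : SmoothMap Domain.interval V) (A : ℝ),
      (∀ j ≤ n, ∀ s, ‖iterDeriv Domain.interval V j f s‖ ≤ A) →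
      ∀ s, ‖iterDeriv Domain.circle V n (extend f) s‖ ≤ C * A := by
  obtain ⟨C, hC⟩ := exists_bound_iterDeriv_halfExtend (V := V) n
  refine ⟨C + C, fun f A hA s => ?_⟩
  have h1 : ∀ j ≤ n, ∀ s, ‖iterDeriv Domain.interval V j (reverseInterval f) s‖ ≤ A :=
    fun j hj s => le_of_le_of_eq (SmoothMap.norm_iterDeriv_pullback_le (I := Domain.interval)
      (I' := Domain.interval) (-1) 1 unitInterval.symm _ _ f j (hA j hj) s) (by simp)
  have h2 : ‖iterDeriv Domain.circle V n (reverseCircle (halfExtend (reverseInterval f))) s‖ ≤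
      C * A :=
    le_of_le_of_eq (SmoothMap.norm_iterDeriv_pullback_le (I := Domain.circle)
      (I' := Domain.circle) (-1) 0 (fun x : UnitAddCircle => -x) _ _
      (halfExtend (reverseInterval f)) n (hC _ A h1) s) (by simp)
  rw [add_mul]
  exact (congrArg norm (congrFun (map_add (iterDeriv Domain.circle V n) (halfExtend f)
    (reverseCircle (halfExtend (reverseInterval f)))) s)).trans_le
    ((norm_add_le _ _).trans (add_le_add (hC f A hA s) h2))

/-- The extension of a nonzero constant need not be constant, so curves are centered first;
constants then go to zero and the map descends to the quotients. Neither map loses derivatives. -/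
theorem isTameSummand_interval_circle :
    (curveGraded Domain.interval V).IsTameSummand (curveGraded Domain.circle V) := by
  have h1 : constMaps Domain.interval V ≤ (constMaps Domain.circle V).comap (extend ∘ₗ center) := by
    rintro f ⟨v, hv⟩
    have h0 : center f = 0 := Subtype.ext (funext fun p => by
      change f.1 p - f.1 (0 : unitInterval) = 0
      exact sub_eq_zero.2 ((hv p).trans (hv _).symm))
    change extend (center f) ∈ constMaps Domain.circle V
    rw [h0, map_zero]
    exact Submodule.zero_mem _
  have h2 : constMaps Domain.circle V ≤ (constMaps Domain.interval V).comap restrictArc := by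
    rintro f ⟨v, hv⟩
    exact ⟨v, fun p => hv _⟩
  refine ⟨curveMap _ h1, curveMap _ h2, isTameLinear_curveMap (r := 0) _ _ fun n => ?_,
    isTameLinear_curveMap (r := 0) _ _ fun n => ?_, fun γ => ?_⟩
  · obtain ⟨C, hC⟩ := exists_bound_iterDeriv_extend (V := V) (n + 1)
    exact ⟨C, fun f s => hC (center f) _ (fun j hj s => norm_iterDeriv_center_le f hj s) s⟩
  · exact ⟨_, fun f s => SmoothMap.norm_iterDeriv_pullback_le (I := Domain.circle)
      (I' := Domain.interval) (1 / 3) (1 / 3) _ _ _ f (n + 1)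
      (fun s => norm_iterDeriv_succ_le (Nat.lt_succ_self n) f s) s⟩
  · obtain ⟨f, rfl⟩ := toCurveMod_surjective γ
    rw [curveMap_toCurveMod, curveMap_toCurveMod]
    exact (congrArg _ (restrictArc_extend (center f))).trans (toCurveMod_center f)

end Extension

theorem isTame_curveGraded_plane (I : Domain) : (curveGraded I Plane).IsTame := by
  refine (isTameSummand_of_continuousLinearEquiv I
    Complex.orthonormalBasisOneI.repr.toContinuousLinearEquiv.symm).isTame_of_isTame ?_
  cases I with
  | interval => exact isTameSummand_interval_circle.isTame_of_isTame isTame_curveGraded_circle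
  | circle => exact isTame_curveGraded_circle

end TameFrechet

end

theorem mainTheorem11 (I : TameFrechet.Domain) :
    TameFrechet.IsTameManifold (TameFrechet.immersions I) (TameFrechet.immersionAtlas I) ∧
    TameFrechet.IsTameSubmanifold (TameFrechet.immersionAtlas I) (TameFrechet.lengthOne I) := by
  exact ⟨TameFrechet.isTameManifold_immersions I (TameFrechet.isTame_curveGraded_plane I),
    TameFrechet.isTameSubmanifold_lengthOne I (TameFrechet.isTame_curveGraded_plane I)⟩
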